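/- **Setting.** Let $n\ge 1$, let $\langle\!\langle\cdot,\cdot\rangle\!\rangle$ be the Minkowski inner product of $\mathbb R^{n+2}_1$, $\|x\|^2=\langle\!\langle x,x\rangle\!\rangle$, $\mathcal L$ the light cone of null vectors, and $S^n=\mathbb P(\mathcal L)$; $\langle x\rangle\in S^n$ is the point spanned by $0\ne x\in\mathcal L$. Put $(v\wedge w)(x)=\langle\!\langle v,x\rangle\!\rangle w-\langle\!\langle w,x\rangle\!\rangle v$. For an $\mathfrak o(\mathbb R^{n+2}_1)$-valued 1-form $\Psi$ on $(0,b)$ and $p\in(0,b)$ let $t\mapsto\Gamma_p^{\,t}(\Psi)$ be the solution of $d\Gamma_p(\Psi)=\Gamma_p(\Psi)\Psi$, $\Gamma_p^{\,p}(\Psi)=\mathrm{id}$. Let $\langle c\rangle:(-\epsilon,b)\to S^n$ ($\epsilon,b>0$) be a smooth regular curve with smooth light cone lift $c$. Let $Q=Q(t)\,dt^2$ be a nowhere zero quadratic differential on $(0,b)$ with a pole of second order at $0$: $t^2Q(t)$ has a smooth extension to some $(-\delta,b)$, $\delta>0$, with value $q\neq0$ at $0$. Let $\omega=\frac{Q(t)}{\|c'(t)\|^2}\,c\wedge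 c'\,dt$. For $\lambda\in\mathbb R$ and $p\in(0,b)$ the $\lambda$-Calapso transform normalized at $p$ is $\langle c_{\lambda,p}(t)\rangle=\langle\Gamma_p^{\,t}(\lambda\omega)c(t)\rangle$, $t\in(0,b)$. Put $\mu=q\lambda$ and fix a pseudo-orthonormal basis $o,\iota,\mathfrak t,\mathfrak n_1,\dots,\mathfrak n_{n-1}$ of $\mathbb R^{n+2}_1$: $o,\iota$ are null with $\langle\!\langle o,\iota\rangle\!\rangle=-1$, the other vectors are orthonormal and orthogonal to $o,\iota$. **Theorem.** Suppose $1-2\mu<0$ (that is, $1-2\lambda<0$ if $Q=dt^2/t^2$). (i) There is a regular parameter $s$, smooth with $s'>0$ on some $(-\delta,b)$, $\delta>0$, with $s(0)=0$ and $Q=q\,ds^2/s^2$ on $(0,b)$. For each such $s$, let $f$ be the flat lift, i.e. the positive multiple of $c$ with $\|df/ds\|^2=1$; then there is a smooth frame $F:(0,b)\to O(\mathbb R^{n+2}_1)$ with $Fo=f$, $F\mathfrak t=df/ds$ for which the normal fields $N_i=F\mathfrak n_i$ are parallel, $\langle\!\langle dN_i,N_j\rangle\!\rangle=0$, and satisfy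 $\langle\!\langle dN_i,df\rangle\!\rangle=0$. (ii) For all $s$ and $F$ as in (i), let $g=FR$, where $R(t)o=s(t)^{-1}o$, $R(t)\iota=s(t)\iota$ and $R(t)=\mathrm{id}$ on $\langle o,\iota\rangle^\perp$, and let $$\xi=-\frac{ds}{s}\,(o-\mathfrak t)\wedge(\iota-\mu\mathfrak t),\qquad \Phi=\Gamma_p(\xi)\,\big(g^{-1}\lambda\omega g+g^{-1}dg\big)\,\Gamma_p(\xi)^{-1}-\xi .$$ Then $\Gamma_p^{\,0}(\Phi):=\lim_{t\to0}\Gamma_p^{\,t}(\Phi)$ exists in $O(\mathbb R^{n+2}_1)$. Let $A=g(p)\,\Gamma_p^{\,0}(\Phi)$, $C(t)=A\,\Gamma_p^{\,t}(\xi)\,o$, and let $\mathcal C\subset S^n$ be the circle of the points $\langle x\rangle$ with $0\neq x\in A\langle o,\iota,\mathfrak t\rangle\cap\mathcal L$. - As $t\to0$, $\langle c_{\lambda,p}(t)\rangle$ tends towards $\langle C(t)\rangle$: their distance with respect to any metric representing the conformal structure of $S^n$ tends to $0$. - $\langle C\rangle$ is a motion on the circle $\mathcal C$ which covers all of $\mathcal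 C$ on every interval $(0,\delta)$, $0<\delta\le b$, and its speed, with respect to any metric representing the conformal structure, tends to infinity as $t\to0$. - In particular $\langle c_{\lambda,p}(t)\rangle$ has no limit as $t\to0$, but it has the limit circle $\mathcal C$: the set of its accumulation points as $t\to0$ is exactly $\mathcal C$. -/

import Mathlib

open Set Filter Topology
open scoped ContDiff ENNReal

noncomputable section

namespace Calapso

/-! ### Minkowski space and the conformal sphere -/

/-- The vector space underlying Minkowski space `ℝ^{n+2}_1`; its Euclidean norm is only used for the
topology and for derivatives. -/
abbrev Mink (n : ℕ) : Type := EuclideanSpace ℝ (Fin (n + 2))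

/-- Endomorphisms of Minkowski space. -/
abbrev EndM (n : ℕ) : Type := Mink n →L[ℝ] Mink n

/-- The Minkowski inner product, of signature `(-,+,…,+)`. -/
def mink {n : ℕ} (x y : Mink n) : ℝ :=
  -(x 0 * y 0) + ∑ i : Fin (n + 1), x i.succ * y i.succ

theorem mink_comm {n : ℕ} (x y : Mink n) : mink x y = mink y x := by
  simp [mink, mul_comm]

theorem mink_add_right {n : ℕ} (v x y : Mink n) : mink v (x + y) = mink v x + mink v y := by
  simp only [mink, PiLp.add_apply, mul_add, Finset.sum_add_distrib]
  ring

theorem mink_smul_right {n : ℕ} (v : Mink n) (r : ℝ) (x : Mink n) :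
    mink v (r • x) = r * mink v x := by
  simp only [mink, PiLp.smul_apply, smul_eq_mul, mul_add, Finset.mul_sum]
  congr 1
  · ring
  · exact Finset.sum_congr rfl fun i _ => by ring

/-- Orthogonal transformations of Minkowski space. -/
def IsLorentz {n : ℕ} (A : EndM n) : Prop := ∀ x y, mink (A x) (A y) = mink x y

/-- The element `v ∧ w : x ↦ ⟨v, x⟩ w - ⟨w, x⟩ v` of the Lie algebra `𝔬(ℝ^{n+2}_1)`. -/
def wedge {n : ℕ} (v w : Mink n) : EndM n :=
  LinearMap.toContinuousLinearMap
    { toFun := fun x => mink v x • w - mink w x • v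
      map_add' := fun x y => by
        simp only [mink_add_right, add_smul]
        abel
      map_smul' := fun r x => by
        simp only [mink_smul_right, mul_smul, smul_sub, RingHom.id_apply] }

/-- The Euclidean space containing the round sphere `S^n`. -/
abbrev Amb (n : ℕ) : Type := EuclideanSpace ℝ (Fin (n + 1))

/-- The identification of the projectivized light cone with the unit sphere `S^n ⊆ ℝ^{n+1}`: the
point `⟨x⟩`, for a nonzero null vector `x = (x₀, x₁, …, x_{n+1})`, is
`(x₁ / x₀, …, x_{n+1} / x₀)`. -/
def pt {n : ℕ} (x : Mink n) : Amb n := WithLp.toLp 2 fun i => x i.succ / x 0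

theorem mink_zero_ne {n : ℕ} {x : Mink n} (hx : x ≠ 0) (h : mink x x = 0) : x 0 ≠ 0 := by
  intro h0
  apply hx
  have h1 : ∑ i : Fin (n + 1), x i.succ * x i.succ = 0 := by simpa [mink, h0] using h
  rw [Finset.sum_eq_zero_iff_of_nonneg fun i _ => mul_self_nonneg _] at h1
  ext i
  refine Fin.cases ?_ (fun j => ?_) i
  · simpa using h0
  · simpa using h1 j (Finset.mem_univ j)

/-- `pt` maps the light cone to the unit sphere. -/
theorem norm_pt {n : ℕ} {x : Mink n} (hx : x ≠ 0) (h : mink x x = 0) : ‖pt x‖ = 1 := by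
  have h0 := mink_zero_ne hx h
  have h1 : ∑ i : Fin (n + 1), x i.succ * x i.succ = x 0 * x 0 := by
    unfold mink at h
    linarith
  rw [EuclideanSpace.norm_eq, Real.sqrt_eq_one]
  have : ∀ i : Fin (n + 1), ‖pt x i‖ ^ 2 = (x i.succ * x i.succ) / (x 0 * x 0) := fun i => by
    simp only [pt, Real.norm_eq_abs, sq_abs]
    field_simp
  rw [Finset.sum_congr rfl fun i _ => this i, ← Finset.sum_div, h1]
  field_simp

/-- Two light cone vectors give the same point of the sphere iff they span the same line. -/
theorem pt_eq_pt_iff {n : ℕ} {x y : Mink n} (hx : x ≠ 0) (hxx : mink x x = 0)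
    (hy : y ≠ 0) (hyy : mink y y = 0) : pt x = pt y ↔ ∃ r : ℝ, r ≠ 0 ∧ y = r • x := by
  have h0 := mink_zero_ne hx hxx
  have h1 := mink_zero_ne hy hyy
  constructor
  · intro h
    refine ⟨y 0 / x 0, div_ne_zero h1 h0, ?_⟩
    ext i
    refine Fin.cases ?_ (fun j => ?_) i
    · simp only [PiLp.smul_apply, smul_eq_mul]
      field_simp
    · have h2 : x j.succ / x 0 = y j.succ / y 0 := congrArg (fun z : Amb n => z j) h
      simp only [PiLp.smul_apply, smul_eq_mul]
      field_simp at h2 ⊢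
      linarith
  · rintro ⟨r, hr, rfl⟩
    ext i
    simp only [pt, PiLp.smul_apply, smul_eq_mul]
    rw [mul_div_mul_left _ _ hr]

/-- The set of points of `S^n` represented by null vectors of the subspace `V`; it is a circle if
`V` is three-dimensional of signature `(-,+,+)`. -/
def sphereOf {n : ℕ} (V : Submodule ℝ (Mink n)) : Set (Amb n) :=
  {P | ∃ x ∈ V, x ≠ 0 ∧ mink x x = 0 ∧ P = pt x}

/-- `φ` is the factor of a representative metric `φ² g_round` of the conformal structure of
`S^n`. -/
def IsConformalFactor {n : ℕ} (φ : Amb n → ℝ) : Prop :=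
  ContinuousOn φ (Metric.sphere 0 1) ∧ ∀ P ∈ Metric.sphere (0 : Amb n) 1, 0 < φ P

/-- The distance of two points of `S^n` with respect to the metric `φ² g_round`: the infimum of the
lengths of the `C¹` curves in the sphere which join them. -/
def conformalDist {n : ℕ} (φ : Amb n → ℝ) (P P' : Amb n) : ℝ≥0∞ :=
  ⨅ (γ : ℝ → Amb n) (_ : ContDiffOn ℝ 1 γ (Icc 0 1) ∧ (∀ u ∈ Icc (0 : ℝ) 1, ‖γ u‖ = 1) ∧
    γ 0 = P ∧ γ 1 = P'),
    ∫⁻ u in Icc (0 : ℝ) 1, ENNReal.ofReal (φ (γ u) * ‖derivWithin γ (Icc 0 1) u‖)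

/-! ### Primitives and gauge transformations

A one-form `Ψ(t) dt` on `(0, b)` is given by its coefficient function `Ψ`. -/

/-- `G` is the primitive of `Ψ(t) dt` on `(0, b)` normalized at `p`: `dG = G Ψ` and `G(p) = id`. -/
def IsPrimitive {n : ℕ} (b : ℝ) (Ψ : ℝ → EndM n) (p : ℝ) (G : ℝ → EndM n) : Prop :=
  G p = 1 ∧ ∀ t ∈ Ioo 0 b, HasDerivAt G (G t * Ψ t) t

/-- `Gam b Ψ p t` is `Γ_p^t(Ψ)`. Only its values for `p, t ∈ (0, b)` are meaningful. -/
def Gam {n : ℕ} (b : ℝ) (Ψ : ℝ → EndM n) (p : ℝ) : ℝ → EndM n :=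
  Classical.epsilon (IsPrimitive b Ψ p)

/-- The terms of the Peano-Baker series, by which primitives are shown to exist. -/
def peano {n : ℕ} (Ψ : ℝ → EndM n) (p : ℝ) : ℕ → ℝ → EndM n
  | 0 => fun _ => 1
  | k + 1 => fun t => ∫ τ in p..t, peano Ψ p k τ * Ψ τ

theorem hasDerivAt_integral_Ioo {n : ℕ} {b p : ℝ} {f : ℝ → EndM n}
    (hf : ContinuousOn f (Ioo 0 b)) (hp : p ∈ Ioo 0 b) {t : ℝ} (ht : t ∈ Ioo 0 b) :
    HasDerivAt (fun u => ∫ τ in p..u, f τ) (f t) t := by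
  have hsub : uIcc p t ⊆ Ioo 0 b := (ordConnected_Ioo).uIcc_subset hp ht
  exact intervalIntegral.integral_hasDerivAt_right ((hf.mono hsub).intervalIntegrable)
    (hf.stronglyMeasurableAtFilter isOpen_Ioo t ht) (hf.continuousAt (isOpen_Ioo.mem_nhds ht))

theorem hasDerivAt_peano {n : ℕ} {b p : ℝ} {Ψ : ℝ → EndM n} (hΨ : ContinuousOn Ψ (Ioo 0 b))
    (hp : p ∈ Ioo 0 b) (k : ℕ) : ∀ t ∈ Ioo 0 b,
      HasDerivAt (peano Ψ p (k + 1)) (peano Ψ p k t * Ψ t) t := by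
  induction k with
  | zero =>
    intro t ht
    exact hasDerivAt_integral_Ioo (continuousOn_const.mul hΨ) hp ht
  | succ k ih =>
    intro t ht
    exact hasDerivAt_integral_Ioo
      (ContinuousOn.mul (fun u hu => (ih u hu).continuousAt.continuousWithinAt) hΨ) hp ht

theorem norm_peano_le {n : ℕ} {p : ℝ} {Ψ : ℝ → EndM n} {K : Set ℝ} [K.OrdConnected] (hp : p ∈ K)
    {M : ℝ} (hM : ∀ t ∈ K, ‖Ψ t‖ ≤ M) (k : ℕ) : ∀ t ∈ K,
      ‖peano Ψ p k t‖ ≤ M ^ k * |t - p| ^ k / k.factorial := by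
  have hM0 : 0 ≤ M := (norm_nonneg _).trans (hM p hp)
  induction k with
  | zero =>
    intro t _
    simp [peano]
  | succ k ih =>
    intro t ht
    have key : ∀ τ ∈ uIoc p t, ‖peano Ψ p k τ * Ψ τ‖ ≤
        M ^ (k + 1) / k.factorial * |τ - p| ^ k := by
      intro τ hτ
      have hτ' : τ ∈ K := ‹K.OrdConnected›.uIcc_subset hp ht (uIoc_subset_uIcc hτ)
      calc ‖peano Ψ p k τ * Ψ τ‖ ≤ ‖peano Ψ p k τ‖ * ‖Ψ τ‖ := norm_mul_le _ _
        _ ≤ (M ^ k * |τ - p| ^ k / k.factorial) * M :=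
          mul_le_mul (ih τ hτ') (hM τ hτ') (norm_nonneg _) (by positivity)
        _ = _ := by ring
    have h1 : ‖peano Ψ p (k + 1) t‖ ≤
        |∫ τ in p..t, M ^ (k + 1) / k.factorial * |τ - p| ^ k| := by
      refine intervalIntegral.norm_integral_le_abs_of_norm_le ?_ ?_
      · exact MeasureTheory.ae_restrict_of_forall_mem measurableSet_uIoc key
      · exact (Continuous.intervalIntegrable (by fun_prop) _ _)
    refine h1.trans (le_of_eq ?_)
    rw [intervalIntegral.integral_const_mul, abs_mul, abs_of_nonneg (by positivity)]
    have h2 : |∫ τ in p..t, |τ - p| ^ k| = |t - p| ^ (k + 1) / (k + 1) := by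
      have := integral_pow_abs_sub_uIoc (a := p) (b := t) k
      rw [← this, intervalIntegral.abs_integral_eq_abs_integral_uIoc, abs_of_nonneg]
      exact MeasureTheory.integral_nonneg fun τ => by positivity
    rw [h2, Nat.factorial_succ]
    push_cast
    field_simp

theorem exists_isPrimitive {n : ℕ} {b p : ℝ} {Ψ : ℝ → EndM n} (hΨ : ContinuousOn Ψ (Ioo 0 b))
    (hp : p ∈ Ioo 0 b) : ∃ G, IsPrimitive b Ψ p G := by
  refine ⟨fun t => ∑' k, peano Ψ p k t, ?_, fun t ht => ?_⟩
  · have : ∀ k, k ≠ 0 → peano Ψ p k p = 0 := by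
      intro k hk
      obtain ⟨j, rfl⟩ := Nat.exists_eq_succ_of_ne_zero hk
      simp [peano]
    simp only []
    rw [tsum_eq_single 0 this]
    rfl
  · obtain ⟨α, hα0, hα⟩ := exists_between (lt_min hp.1 ht.1)
    obtain ⟨β, hβ, hβb⟩ := exists_between (max_lt hp.2 ht.2)
    have hK : Icc α β ⊆ Ioo 0 b := fun x hx => ⟨hα0.trans_le hx.1, hx.2.trans_lt hβb⟩
    have hpI : p ∈ Ioo α β := ⟨hα.trans_le (min_le_left _ _), (le_max_left _ _).trans_lt hβ⟩
    have htI : t ∈ Ioo α β := ⟨hα.trans_le (min_le_right _ _), (le_max_right _ _).trans_lt hβ⟩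
    obtain ⟨M, hM⟩ := isCompact_Icc.exists_bound_of_continuousOn (hΨ.mono hK)
    have hM0 : 0 ≤ M := (norm_nonneg _).trans (hM p (Ioo_subset_Icc_self hpI))
    have hb : ∀ k, ∀ u ∈ Ioo α β, ‖peano Ψ p k u‖ ≤ (M * (β - α)) ^ k / k.factorial := by
      intro k u hu
      refine (norm_peano_le (Ioo_subset_Icc_self hpI) hM k u (Ioo_subset_Icc_self hu)).trans ?_
      rw [mul_pow]
      gcongr
      rw [abs_le]
      constructor <;> linarith [hu.1, hu.2, hpI.1, hpI.2]
    have hs : Summable fun k : ℕ => (M * (β - α)) ^ k / k.factorial :=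
      Real.summable_pow_div_factorial _
    have hsum : ∀ u ∈ Ioo α β, Summable fun k => peano Ψ p k u := fun u hu =>
      Summable.of_norm_bounded hs fun k => hb k u hu
    have hg : ∀ (k : ℕ) (u : ℝ), u ∈ Ioo α β →
        HasDerivAt (peano Ψ p (k + 1)) (peano Ψ p k u * Ψ u) u := fun k u hu =>
      hasDerivAt_peano hΨ hp k u (hK (Ioo_subset_Icc_self hu))
    have hg' : ∀ (k : ℕ) (u : ℝ), u ∈ Ioo α β →
        ‖peano Ψ p k u * Ψ u‖ ≤ (M * (β - α)) ^ k / k.factorial * M := fun k u hu =>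
      (norm_mul_le _ _).trans (mul_le_mul (hb k u hu)
        (hM u (Ioo_subset_Icc_self hu)) (norm_nonneg _) ((norm_nonneg _).trans (hb k u hu)))
    have h0 : Summable fun k => peano Ψ p (k + 1) p :=
      (summable_nat_add_iff (f := fun k => peano Ψ p k p) 1).2 (hsum p hpI)
    have hd : HasDerivAt (fun z => ∑' k, peano Ψ p (k + 1) z) (∑' k, peano Ψ p k t * Ψ t) t :=
      hasDerivAt_tsum_of_isPreconnected (hs.mul_right M) isOpen_Ioo isPreconnected_Ioo hg hg'
        hpI h0 htI
    rw [(hsum t htI).tsum_mul_right] at hd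
    have he : (fun z => ∑' k, peano Ψ p k z) =ᶠ[𝓝 t]
        fun z => 1 + ∑' k, peano Ψ p (k + 1) z := by
      filter_upwards [isOpen_Ioo.mem_nhds htI] with u hu
      exact (hsum u hu).tsum_eq_zero_add
    exact (hd.const_add (1 : EndM n)).congr_of_eventuallyEq he

theorem gam_spec {n : ℕ} {b p : ℝ} {Ψ : ℝ → EndM n} (hΨ : ContinuousOn Ψ (Ioo 0 b))
    (hp : p ∈ Ioo 0 b) : IsPrimitive b Ψ p (Gam b Ψ p) :=
  Classical.epsilon_spec (exists_isPrimitive hΨ hp)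

theorem IsPrimitive.eqOn {n : ℕ} {b p : ℝ} {Ψ : ℝ → EndM n} (hΨ : ContinuousOn Ψ (Ioo 0 b))
    (hp : p ∈ Ioo 0 b) {G H : ℝ → EndM n} (hG : IsPrimitive b Ψ p G) (hH : IsPrimitive b Ψ p H) :
    EqOn G H (Ioo 0 b) := by
  intro t ht
  obtain ⟨α, hα0, hα⟩ := exists_between (lt_min hp.1 ht.1)
  obtain ⟨β, hβ, hβb⟩ := exists_between (max_lt hp.2 ht.2)
  have hK : Icc α β ⊆ Ioo 0 b := fun x hx => ⟨hα0.trans_le hx.1, hx.2.trans_lt hβb⟩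
  have hpI : p ∈ Ioo α β := ⟨hα.trans_le (min_le_left _ _), (le_max_left _ _).trans_lt hβ⟩
  have htI : t ∈ Ioo α β := ⟨hα.trans_le (min_le_right _ _), (le_max_right _ _).trans_lt hβ⟩
  obtain ⟨M, hM⟩ := isCompact_Icc.exists_bound_of_continuousOn (hΨ.mono hK)
  refine ODE_solution_unique_of_mem_Ioo (v := fun u X => X * Ψ u) (s := fun _ => univ)
    (K := M.toNNReal) (fun u hu => LipschitzOnWith.of_dist_le_mul fun X _ Y _ => ?_) hpI
    (fun u hu => ⟨hG.2 u (hK (Ioo_subset_Icc_self hu)), mem_univ _⟩)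
    (fun u hu => ⟨hH.2 u (hK (Ioo_subset_Icc_self hu)), mem_univ _⟩)
    (hG.1.trans hH.1.symm) htI
  rw [dist_eq_norm, dist_eq_norm, ← sub_mul, mul_comm (M.toNNReal : ℝ)]
  refine (norm_mul_le _ _).trans (mul_le_mul_of_nonneg_left ?_ (norm_nonneg _))
  exact (hM u (Ioo_subset_Icc_self hu)).trans (Real.le_coe_toNNReal M)

/-- The gauge transform `g⁻¹ Ψ g + g⁻¹ dg` of `Ψ`. -/
def gauge {n : ℕ} (g Ψ : ℝ → EndM n) : ℝ → EndM n := fun t =>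
  Ring.inverse (g t) * Ψ t * g t + Ring.inverse (g t) * deriv g t

/-- The gauge transform `Γ_p(Ξ) Ψ Γ^p(Ξ) - Ξ` of `Ψ`. -/
def gaugeBy {n : ℕ} (b : ℝ) (Ξ : ℝ → EndM n) (p : ℝ) (Ψ : ℝ → EndM n) : ℝ → EndM n := fun t =>
  Gam b Ξ p t * Ψ t * Gam b Ξ t p - Ξ t

/-! ### Polarized curves and their Calapso transforms -/

/-- `c` is a smooth light cone lift of a regular curve `⟨c⟩` in `S^n` on the open interval `I`. For
a light cone lift, `⟨c⟩` is immersed exactly where `‖c'‖² > 0`. -/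
def IsRegularLift {n : ℕ} (c : ℝ → Mink n) (I : Set ℝ) : Prop :=
  ContDiffOn ℝ ∞ c I ∧
    ∀ t ∈ I, c t ≠ 0 ∧ mink (c t) (c t) = 0 ∧ 0 < mink (deriv c t) (deriv c t)

/-- The quadratic differential `Q(t) dt²` on `(0, b)` has a pole of order `k` at `0`, and `q` is the
nonzero value at `0` of the smooth extension of `Q(t) (0 - t)^k`. -/
def HasPole (k : ℕ) (b : ℝ) (Q : ℝ → ℝ) (q : ℝ) : Prop :=
  q ≠ 0 ∧ ∃ δ > 0, ∃ h : ℝ → ℝ, ContDiffOn ℝ ∞ h (Ioo (-δ) b) ∧ h 0 = q ∧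
    ∀ t ∈ Ioo 0 b, h t = Q t * (0 - t) ^ k

/-- The (orthogonal lift of the) one-form `ω = 𝔔 c ∧ dc` associated to the polarized curve
`(⟨c⟩, Q)`, where `Q = 𝔔 ‖dc‖²`. -/
def assocForm {n : ℕ} (c : ℝ → Mink n) (Q : ℝ → ℝ) : ℝ → EndM n := fun t =>
  (Q t / mink (deriv c t) (deriv c t)) • wedge (c t) (deriv c t)

/-- The lift `Γ_p(λω) c` of the `λ`-Calapso transform of `(⟨c⟩, Q)` normalized at `p`. -/
def calapso {n : ℕ} (b : ℝ) (c : ℝ → Mink n) (Q : ℝ → ℝ) (lam p t : ℝ) : Mink n :=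
  Gam b (lam • assocForm c Q) p t (c t)

/-! ### The singular frame -/

/-- A pseudo-orthonormal basis `{o, ι, 𝔱, 𝔫₁, …, 𝔫_{n-1}}` of Minkowski space. -/
structure PseudoBasis (n : ℕ) where
  o : Mink n
  ι : Mink n
  τ : Mink n
  ν : Fin (n - 1) → Mink n
  o_o : mink o o = 0
  ι_ι : mink ι ι = 0
  o_ι : mink o ι = -1
  τ_τ : mink τ τ = 1
  o_τ : mink o τ = 0
  ι_τ : mink ι τ = 0
  o_ν : ∀ i, mink o (ν i) = 0
  ι_ν : ∀ i, mink ι (ν i) = 0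
  τ_ν : ∀ i, mink τ (ν i) = 0
  ν_ν : ∀ i j, mink (ν i) (ν j) = if i = j then 1 else 0

/-- `s` is a regular parameter near `[0, b)` with `s(0) = 0` in which the quadratic differential `Q`
takes the form `q ds² / s²`. -/
def IsNormalParam (b : ℝ) (Q : ℝ → ℝ) (q : ℝ) (s : ℝ → ℝ) : Prop :=
  (∃ δ > 0, ContDiffOn ℝ ∞ s (Ioo (-δ) b) ∧ ∀ t ∈ Ioo (-δ) b, 0 < deriv s t) ∧ s 0 = 0 ∧
    ∀ t ∈ Ioo 0 b, Q t = q * (deriv s t) ^ 2 / (s t) ^ 2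

/-- The flat lift of `⟨c⟩` with respect to the parameter `s`, that is, the positive multiple of `c`
whose derivative with respect to `s` has unit length. -/
def flatLift {n : ℕ} (c : ℝ → Mink n) (s : ℝ → ℝ) (t : ℝ) : Mink n :=
  (deriv s t / √(mink (deriv c t) (deriv c t))) • c t

/-- `F` is a smooth orthogonal frame which maps `o`, `𝔱` to the flat lift `f` and its derivative
`df/ds`, and the `𝔫ᵢ` to orthonormal normal fields `Nᵢ` which are parallel and satisfy
`⟨dNᵢ, df⟩ = 0`. Being orthogonal, `F` maps `ι` to the null vector `f̄` with `⟨f, f̄⟩ = -1` which is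
orthogonal to `df` and all `Nᵢ`. -/
def IsCurveFrame {n : ℕ} (b : ℝ) (c : ℝ → Mink n) (s : ℝ → ℝ) (e : PseudoBasis n)
    (F : ℝ → EndM n) : Prop :=
  ContDiffOn ℝ ∞ F (Ioo 0 b) ∧ ∀ t ∈ Ioo 0 b,
    IsLorentz (F t) ∧
    F t e.o = flatLift c s t ∧
    F t e.τ = (deriv s t)⁻¹ • deriv (flatLift c s) t ∧
    (∀ i, mink (deriv (fun u => F u (e.ν i)) t) (deriv (flatLift c s) t) = 0) ∧
    ∀ i j, mink (deriv (fun u => F u (e.ν i)) t) (F t (e.ν j)) = 0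

/-- The orthogonal transformation `o ↦ r⁻¹ o`, `ι ↦ r ι` which is the identity on `⟨o, ι⟩^⊥`. -/
def boost {n : ℕ} (e : PseudoBasis n) (r : ℝ) : EndM n :=
  LinearMap.toContinuousLinearMap
    { toFun := fun x => x + ((1 - r⁻¹) * mink e.ι x) • e.o + ((1 - r) * mink e.o x) • e.ι
      map_add' := fun x y => by
        simp only [mink_add_right, mul_add, add_smul]
        abel
      map_smul' := fun a x => by
        simp only [mink_smul_right, smul_add, smul_smul, RingHom.id_apply]
        ring_nf }

theorem boost_o {n : ℕ} (e : PseudoBasis n) (r : ℝ) : boost e r e.o = r⁻¹ • e.o := by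
  simp only [boost, LinearMap.coe_toContinuousLinearMap', LinearMap.coe_mk, AddHom.coe_mk, e.o_o,
    mink_comm e.ι e.o, e.o_ι]
  module

theorem boost_ι {n : ℕ} (e : PseudoBasis n) (r : ℝ) : boost e r e.ι = r • e.ι := by
  simp only [boost, LinearMap.coe_toContinuousLinearMap', LinearMap.coe_mk, AddHom.coe_mk, e.ι_ι,
    e.o_ι]
  module

theorem boost_of_orthogonal {n : ℕ} (e : PseudoBasis n) (r : ℝ) {x : Mink n}
    (ho : mink e.o x = 0) (hι : mink e.ι x = 0) : boost e r x = x := by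
  simp [boost, ho, hι]

/-- The singular frame `g = F R`, where `R(t)` scales `o` by `1 / s(t)` and `ι` by `s(t)`. -/
def singFrame {n : ℕ} (s : ℝ → ℝ) (e : PseudoBasis n) (F : ℝ → EndM n) : ℝ → EndM n := fun t =>
  F t * boost e (s t)

/-- The pure pole form `ξ_μ = -(ds / s) (o - 𝔱) ∧ (ι - μ 𝔱)`. -/
def poleForm {n : ℕ} (s : ℝ → ℝ) (e : PseudoBasis n) (μ : ℝ) : ℝ → EndM n := fun t =>
  -(deriv s t / s t) • wedge (e.o - e.τ) (e.ι - μ • e.τ)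

end Calapso

end

/-!
Gauging `λω` by `g = FR` turns it into the pure pole form `ξ` plus a remainder that tends to `0`
with `s`. As `1 - 2μ < 0`, the form `ξ` generates a one-parameter group of rotations in the variable
`log s`, which is bounded; hence `Φ`, the conjugate of the remainder by these rotations, also tends
to `0` and `Γ_p(Φ)` has a limit. Since `g(p) Γ_p(Φ) Γ_p(ξ) = Γ_p(λω) g`, the Calapso transform is
asymptotic to the orbit of a point under the rotations generated by `ξ`. As `log s → -∞`, this orbit
winds infinitely often around its circle, with speed growing like `1 / s`.
-/

noncomputable section

namespace Calapso

set_option maxSynthPendingDepth 3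

/-! ### The Minkowski inner product -/

section Minkowski

variable {n : ℕ}

theorem mink_add_left (x y v : Mink n) : mink (x + y) v = mink x v + mink y v := by
  simp only [mink_comm _ v, mink_add_right]

theorem mink_smul_left (r : ℝ) (x v : Mink n) : mink (r • x) v = r * mink x v := by
  simp only [mink_comm _ v, mink_smul_right]

/-- The Minkowski inner product as a continuous bilinear map. -/
def minkForm (n : ℕ) : Mink n →L[ℝ] Mink n →L[ℝ] ℝ :=
  (LinearMap.mk₂ ℝ mink mink_add_left mink_smul_left mink_add_right
    fun r v x => mink_smul_right v r x).toContinuousBilinearMap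

theorem minkForm_apply (x y : Mink n) : minkForm n x y = mink x y := rfl

theorem mink_zero_right (v : Mink n) : mink v 0 = 0 := map_zero (minkForm n v)

theorem mink_zero_left (v : Mink n) : mink 0 v = 0 := by rw [mink_comm, mink_zero_right]

theorem mink_neg_right (v x : Mink n) : mink v (-x) = -mink v x := map_neg (minkForm n v) x

theorem mink_neg_left (v x : Mink n) : mink (-v) x = -mink v x := by
  rw [mink_comm, mink_neg_right, mink_comm]

theorem mink_sub_right (v x y : Mink n) : mink v (x - y) = mink v x - mink v y :=
  map_sub (minkForm n v) x y

theorem mink_sub_left (x y v : Mink n) : mink (x - y) v = mink x v - mink y v := by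
  simp only [mink_comm _ v, mink_sub_right]

theorem mink_sum_right {κ : Type*} (S : Finset κ) (v : Mink n) (x : κ → Mink n) :
    mink v (∑ i ∈ S, x i) = ∑ i ∈ S, mink v (x i) :=
  map_sum (minkForm n v) x S

theorem mink_sum_left {κ : Type*} (S : Finset κ) (v : Mink n) (x : κ → Mink n) :
    mink (∑ i ∈ S, x i) v = ∑ i ∈ S, mink (x i) v := by
  simp only [mink_comm _ v, mink_sum_right]

theorem tendsto_mink {α : Type*} {l : Filter α} {x y : α → Mink n} {v w : Mink n}
    (hx : Tendsto x l (𝓝 v)) (hy : Tendsto y l (𝓝 w)) :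
    Tendsto (fun u => mink (x u) (y u)) l (𝓝 (mink v w)) :=
  ((minkForm n).continuous₂.tendsto (v, w)).comp (hx.prodMk_nhds hy)

theorem hasDerivAt_mink {x y : ℝ → Mink n} {x' y' : Mink n} {t : ℝ}
    (hx : HasDerivAt x x' t) (hy : HasDerivAt y y' t) :
    HasDerivAt (fun u => mink (x u) (y u)) (mink x' (y t) + mink (x t) y') t :=
  ((minkForm n).hasDerivAt_of_bilinear (fun _ => hx) fun _ => hy).congr_deriv (add_comm _ _)

theorem contDiffOn_mink {x y : ℝ → Mink n} {m : WithTop ℕ∞} {I : Set ℝ}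
    (hx : ContDiffOn ℝ m x I) (hy : ContDiffOn ℝ m y I) :
    ContDiffOn ℝ m (fun u => mink (x u) (y u)) I :=
  (minkForm n).isBoundedBilinearMap.contDiff.comp_contDiffOn (hx.prodMk hy)

/-- The projection of Minkowski space onto its last `n + 1` coordinates. -/
def spatial (n : ℕ) : Mink n →L[ℝ] Amb n :=
  LinearMap.toContinuousLinearMap
    { toFun := fun x => WithLp.toLp 2 fun i => x i.succ
      map_add' := fun _ _ => rfl
      map_smul' := fun _ _ => rfl }

theorem spatial_apply (x : Mink n) (i : Fin (n + 1)) : spatial n x i = x i.succ := rfl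

theorem mink_eq_spatial (x y : Mink n) :
    mink x y = -(x 0 * y 0) + inner ℝ (spatial n x) (spatial n y) := by
  simp only [mink, PiLp.inner_apply, spatial_apply, RCLike.inner_apply, conj_trivial, mul_comm]

theorem ext_spatial {x y : Mink n} (h₀ : x 0 = y 0) (h : spatial n x = spatial n y) : x = y := by
  ext i
  exact Fin.cases h₀ (fun j => congrArg (fun z : Amb n => z j) h) i

theorem mink_self_pos_of_orthogonal {u x : Mink n} (hu : mink u u < 0) (hux : mink u x = 0)
    (hx : x ≠ 0) : 0 < mink x x := by
  by_contra! hle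
  rw [mink_eq_spatial, real_inner_self_eq_norm_sq] at hu hle
  rw [mink_eq_spatial] at hux
  have hcs := real_inner_mul_inner_self_le (spatial n u) (spatial n x)
  rw [real_inner_self_eq_norm_sq, real_inner_self_eq_norm_sq,
    show inner ℝ (spatial n u) (spatial n x) = u 0 * x 0 by linarith] at hcs
  have hx₀ : x 0 = 0 := by
    by_contra hne
    have : 0 < x 0 ^ 2 := by positivity
    nlinarith [sq_nonneg ‖spatial n u‖]
  refine hx (ext_spatial hx₀ ?_)
  rw [map_zero, ← norm_eq_zero, ← sq_eq_zero_iff]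
  nlinarith [sq_nonneg ‖spatial n x‖]

/-- The reflection in the space-like coordinate hyperplane, which relates the Minkowski and the
Euclidean inner product. -/
def timeFlip (n : ℕ) : Mink n ≃ₗᵢ[ℝ] Mink n :=
  (ℝ ∙ (EuclideanSpace.single 0 1 : Mink n))ᗮ.reflection

theorem timeFlip_timeFlip (x : Mink n) : timeFlip n (timeFlip n x) = x :=
  Submodule.reflection_reflection _ x

theorem mink_eq_inner (x y : Mink n) : mink x y = inner ℝ (timeFlip n x) y := by
  rw [timeFlip, Submodule.reflection_orthogonal_apply, Submodule.reflection_singleton_apply,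
    neg_sub, inner_sub_left, two_smul, inner_add_left, inner_smul_left,
    EuclideanSpace.inner_single_left, EuclideanSpace.inner_single_left, PiLp.inner_apply,
    Fin.sum_univ_succ]
  simp only [mink, PiLp.norm_single, RCLike.inner_apply, conj_trivial, norm_one,
    mul_comm (x _), one_pow, div_one, map_one, one_mul]
  ring

theorem mink_ext {x y : Mink n} (h : ∀ z, mink z x = mink z y) : x = y := by
  refine ext_inner_left ℝ fun z => ?_
  simpa only [mink_eq_inner, timeFlip_timeFlip] using h (timeFlip n z)

/-! ### Adjoints and orthogonal transformations -/

/-- The adjoint of an endomorphism with respect to the Minkowski inner product. -/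
def minkAdjoint (A : EndM n) : EndM n :=
  (timeFlip n : EndM n) * ContinuousLinearMap.adjoint A * (timeFlip n : EndM n)

theorem mink_minkAdjoint_left (A : EndM n) (x y : Mink n) :
    mink (minkAdjoint A x) y = mink x (A y) := by
  rw [mink_eq_inner, mink_eq_inner, ← ContinuousLinearMap.adjoint_inner_left]
  exact congrArg (inner ℝ · y) (timeFlip_timeFlip _)

theorem mink_minkAdjoint_right (A : EndM n) (x y : Mink n) :
    mink x (minkAdjoint A y) = mink (A x) y := by
  rw [mink_comm, mink_minkAdjoint_left, mink_comm]

theorem minkAdjoint_eq {A A' : EndM n} (h : ∀ x y, mink (A' x) y = mink x (A y)) :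
    minkAdjoint A = A' :=
  ContinuousLinearMap.ext fun x => mink_ext fun z => by
    rw [mink_minkAdjoint_right, mink_comm z, h, mink_comm]

theorem minkAdjoint_mul (A B : EndM n) : minkAdjoint (A * B) = minkAdjoint B * minkAdjoint A :=
  minkAdjoint_eq fun x y => by simp only [mul_apply_eq_comp, mink_minkAdjoint_left]

theorem minkAdjoint_minkAdjoint (A : EndM n) : minkAdjoint (minkAdjoint A) = A :=
  minkAdjoint_eq fun x y => (mink_minkAdjoint_right A x y).symm

theorem continuous_minkAdjoint : Continuous (minkAdjoint : EndM n → EndM n) := by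
  unfold minkAdjoint
  fun_prop

theorem hasDerivAt_minkAdjoint {A : ℝ → EndM n} {A' : EndM n} {t : ℝ} (h : HasDerivAt A A' t) :
    HasDerivAt (fun u => minkAdjoint (A u)) (minkAdjoint A') t :=
  (h.star.const_mul (timeFlip n : EndM n)).mul_const (timeFlip n : EndM n)

theorem isLorentz_iff {A : EndM n} : IsLorentz A ↔ minkAdjoint A * A = 1 := by
  refine ⟨fun h => ContinuousLinearMap.ext fun x => mink_ext fun z => ?_, fun h x y => ?_⟩
  · rw [mul_apply_eq_comp, mink_minkAdjoint_right, h, one_apply_eq_self]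
  · rw [← mink_minkAdjoint_left, ← mul_apply_eq_comp, h, one_apply_eq_self]

theorem mul_eq_one_comm_of_finiteDimensional {𝕜 E : Type*} [NontriviallyNormedField 𝕜]
    [NormedAddCommGroup E] [NormedSpace 𝕜 E] [FiniteDimensional 𝕜 E] {A B : E →L[𝕜] E} :
    A * B = 1 ↔ B * A = 1 := by
  rw [← ContinuousLinearMap.coe_inj, ← ContinuousLinearMap.coe_inj]
  exact mul_eq_one_comm (M := E →ₗ[𝕜] E)

namespace IsLorentz

variable {A B : EndM n}

theorem adjoint_mul_self (hA : IsLorentz A) : minkAdjoint A * A = 1 := isLorentz_iff.1 hA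

theorem mul_adjoint_self (hA : IsLorentz A) : A * minkAdjoint A = 1 :=
  mul_eq_one_comm_of_finiteDimensional.1 hA.adjoint_mul_self

theorem adjoint_apply_apply (hA : IsLorentz A) (x : Mink n) : minkAdjoint A (A x) = x :=
  congrArg (fun B : EndM n => B x) hA.adjoint_mul_self

theorem adjoint (hA : IsLorentz A) : IsLorentz (minkAdjoint A) :=
  isLorentz_iff.2 (by rw [minkAdjoint_minkAdjoint, hA.mul_adjoint_self])

theorem mul (hA : IsLorentz A) (hB : IsLorentz B) : IsLorentz (A * B) :=
  fun x y => by rw [mul_apply_eq_comp, mul_apply_eq_comp, hA, hB]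

theorem apply_ne_zero (hA : IsLorentz A) {x : Mink n} (hx : x ≠ 0) : A x ≠ 0 := fun h => hx <| by
  rw [← hA.adjoint_apply_apply x, h, map_zero]

theorem inverse_eq (hA : IsLorentz A) : Ring.inverse A = minkAdjoint A :=
  Ring.inverse_unit (⟨A, minkAdjoint A, hA.mul_adjoint_self, hA.adjoint_mul_self⟩ : (EndM n)ˣ)

theorem mul_wedge (hA : IsLorentz A) (v w : Mink n) :
    A * wedge v w = wedge (A v) (A w) * A := by
  ext1 x
  change A (mink v x • w - mink w x • v) = mink (A v) (A x) • A w - mink (A w) (A x) • A v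
  rw [map_sub, map_smul, map_smul, hA v x, hA w x]

theorem of_tendsto {α : Type*} {l : Filter α} [l.NeBot] {G : α → EndM n}
    (hG : ∀ᶠ t in l, IsLorentz (G t)) (h : Tendsto G l (𝓝 A)) : IsLorentz A := fun x y =>
  tendsto_nhds_unique
    (tendsto_mink (((ContinuousLinearMap.apply ℝ (Mink n) x).continuous.tendsto A).comp h)
      (((ContinuousLinearMap.apply ℝ (Mink n) y).continuous.tendsto A).comp h))
    (tendsto_const_nhds.congr' (hG.mono fun _ ht => (ht x y).symm))

end IsLorentz

/-- `A` belongs to the Lie algebra `𝔬(ℝ^{n+2}_1)` of the Lorentz group. -/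
def IsSkew (A : EndM n) : Prop := ∀ x y, mink (A x) y = -mink x (A y)

namespace IsSkew

variable {A B : EndM n}

theorem adjoint_eq (hA : IsSkew A) : minkAdjoint A = -A :=
  minkAdjoint_eq fun x y => by rw [_root_.neg_apply, mink_neg_left, hA, neg_neg]

theorem smul (hA : IsSkew A) (r : ℝ) : IsSkew (r • A) := fun x y => by
  simp only [_root_.smul_apply, mink_smul_left, mink_smul_right, hA x y, mul_neg]

theorem neg (hA : IsSkew A) : IsSkew (-A) := fun x y => by
  simp only [_root_.neg_apply, mink_neg_left, mink_neg_right, hA x y]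

theorem sub (hA : IsSkew A) (hB : IsSkew B) : IsSkew (A - B) := fun x y => by
  simp only [_root_.sub_apply, mink_sub_left, mink_sub_right, hA x y, hB x y]
  ring

theorem conj (hB : IsSkew B) (A : EndM n) : IsSkew (A * B * minkAdjoint A) := fun x y => by
  simp only [mul_apply_eq_comp]
  rw [← mink_minkAdjoint_right, hB, mink_minkAdjoint_left]

end IsSkew

theorem isSkew_deriv_mul_adjoint {F : ℝ → EndM n} {F' : EndM n} {t : ℝ}
    (hF : ∀ᶠ u in 𝓝 t, IsLorentz (F u)) (hF' : HasDerivAt F F' t) :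
    IsSkew (F' * minkAdjoint (F t)) := fun x y => by
  have hcol (z : Mink n) : HasDerivAt (fun u => F u z) (F' z) t :=
    (hF'.clm_apply (hasDerivAt_const t z)).congr_deriv (by rw [map_zero, add_zero])
  have h := (hasDerivAt_mink (hcol (minkAdjoint (F t) x)) (hcol (minkAdjoint (F t) y))).unique
    ((hasDerivAt_const t _).congr_of_eventuallyEq (hF.mono fun u hu => hu _ _))
  simp only [← mul_apply_eq_comp, hF.self_of_nhds.mul_adjoint_self, one_apply_eq_self] at h
  exact eq_neg_of_add_eq_zero_left h

theorem wedge_apply (v w x : Mink n) : wedge v w x = mink v x • w - mink w x • v := rfl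

theorem isSkew_wedge (v w : Mink n) : IsSkew (wedge v w) := fun x y => by
  simp only [wedge_apply, mink_sub_left, mink_smul_left, mink_comm x]
  ring

/-- The wedge product as a continuous bilinear map. -/
def wedgeMap (n : ℕ) : Mink n →L[ℝ] Mink n →L[ℝ] EndM n :=
  ((ContinuousLinearMap.smulRightL ℝ (Mink n) (Mink n)).comp (minkForm n)) -
    ((ContinuousLinearMap.smulRightL ℝ (Mink n) (Mink n)).comp (minkForm n)).flip

theorem wedgeMap_apply (v w : Mink n) : wedgeMap n v w = wedge v w := rfl

theorem wedge_smul_left (r : ℝ) (v w : Mink n) : wedge (r • v) w = r • wedge v w := by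
  simp only [← wedgeMap_apply, map_smul, _root_.smul_apply]

theorem wedge_add_right (v w w' : Mink n) : wedge v (w + w') = wedge v w + wedge v w' :=
  map_add (wedgeMap n v) w w'

theorem wedge_smul_right (r : ℝ) (v w : Mink n) : wedge v (r • w) = r • wedge v w :=
  map_smul (wedgeMap n v) r w

theorem wedge_self (v : Mink n) : wedge v v = 0 :=
  ContinuousLinearMap.ext fun _ => sub_self _

theorem contDiffOn_wedge {x y : ℝ → Mink n} {m : WithTop ℕ∞} {I : Set ℝ}
    (hx : ContDiffOn ℝ m x I) (hy : ContDiffOn ℝ m y I) :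
    ContDiffOn ℝ m (fun u => wedge (x u) (y u)) I :=
  (wedgeMap n).isBoundedBilinearMap.contDiff.comp_contDiffOn (hx.prodMk hy)

end Minkowski

/-! ### Pseudo-orthonormal bases -/

section PseudoBasis

variable {n : ℕ}

namespace PseudoBasis

variable (e e' : PseudoBasis n)

/-- The vector with coefficients `a, b, d, k` with respect to a pseudo-orthonormal basis. -/
def comb (a b d : ℝ) (k : Fin (n - 1) → ℝ) : Mink n :=
  a • e.o + b • e.ι + d • e.τ + ∑ i, k i • e.ν i

theorem mink_o_comb (a b d : ℝ) (k : Fin (n - 1) → ℝ) : mink e.o (e.comb a b d k) = -b := by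
  simp [comb, mink_add_right, mink_smul_right, mink_sum_right, e.o_o, e.o_ι, e.o_τ, e.o_ν]

theorem mink_ι_comb (a b d : ℝ) (k : Fin (n - 1) → ℝ) : mink e.ι (e.comb a b d k) = -a := by
  simp [comb, mink_add_right, mink_smul_right, mink_sum_right, e.ι_ι, mink_comm e.ι e.o, e.o_ι,
    e.ι_τ, e.ι_ν]

theorem mink_τ_comb (a b d : ℝ) (k : Fin (n - 1) → ℝ) : mink e.τ (e.comb a b d k) = d := by
  simp [comb, mink_add_right, mink_smul_right, mink_sum_right, mink_comm e.τ e.o,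
    mink_comm e.τ e.ι, e.o_τ, e.ι_τ, e.τ_τ, e.τ_ν]

theorem mink_ν_comb (j : Fin (n - 1)) (a b d : ℝ) (k : Fin (n - 1) → ℝ) :
    mink (e.ν j) (e.comb a b d k) = k j := by
  simp [comb, mink_add_right, mink_smul_right, mink_sum_right, mink_comm (e.ν j) e.o,
    mink_comm (e.ν j) e.ι, mink_comm (e.ν j) e.τ, e.o_ν, e.ι_ν, e.τ_ν, e.ν_ν]

/-- The coordinates of a vector, as its inner products with the basis vectors; the `o`- and the
`ι`-coordinate are interchanged and have the opposite sign. -/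
def pairing : Mink n →ₗ[ℝ] ℝ × ℝ × ℝ × (Fin (n - 1) → ℝ) where
  toFun x := (mink e.o x, mink e.ι x, mink e.τ x, fun i => mink (e.ν i) x)
  map_add' x y := by ext <;> simp [mink_add_right]
  map_smul' r x := by ext <;> simp [mink_smul_right]

theorem pairing_injective (hn : 1 ≤ n) : Function.Injective e.pairing := by
  have hd : Module.finrank ℝ (Mink n) = Module.finrank ℝ (ℝ × ℝ × ℝ × (Fin (n - 1) → ℝ)) := by
    simp only [Module.finrank_prod, Module.finrank_self, Module.finrank_fin_fun,
      finrank_euclideanSpace_fin]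
    omega
  rw [LinearMap.injective_iff_surjective_of_finrank_eq_finrank hd]
  rintro ⟨a, b, d, k⟩
  refine ⟨e.comb (-b) (-a) d k, ?_⟩
  simp [pairing, mink_o_comb, mink_ι_comb, mink_τ_comb, mink_ν_comb]

theorem eq_comb (hn : 1 ≤ n) (x : Mink n) :
    x = e.comb (-mink e.ι x) (-mink e.o x) (mink e.τ x) fun i => mink (e.ν i) x :=
  e.pairing_injective hn <| by
    simp [pairing, mink_o_comb, mink_ι_comb, mink_τ_comb, mink_ν_comb]

theorem ext_endM (hn : 1 ≤ n) {A B : EndM n} (ho : A e.o = B e.o) (hι : A e.ι = B e.ι)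
    (hτ : A e.τ = B e.τ) (hν : ∀ i, A (e.ν i) = B (e.ν i)) : A = B := by
  ext1 x
  rw [e.eq_comb hn x]
  simp only [comb, map_add, map_smul, map_sum, ho, hι, hτ, hν]

theorem eq_ι (hn : 1 ≤ n) {x : Mink n} (hxx : mink x x = 0) (ho : mink e.o x = -1)
    (hτ : mink e.τ x = 0) (hν : ∀ i, mink (e.ν i) x = 0) : x = e.ι := by
  have hx := e.eq_comb hn x
  simp only [ho, hτ, hν, neg_neg, comb, zero_smul, Finset.sum_const_zero, add_zero, one_smul] at hx
  have hιx : mink e.ι x = 0 := by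
    rw [hx] at hxx
    simp only [mink_add_left, mink_add_right, mink_smul_left, mink_smul_right, e.o_o, e.o_ι, e.ι_ι,
      mink_comm e.ι e.o] at hxx
    linarith
  rw [hx, hιx, neg_zero, zero_smul, zero_add]

theorem ext_isSkew (hn : 1 ≤ n) {A B : EndM n} (hA : IsSkew A) (hB : IsSkew B)
    (ho : A e.o = B e.o) (hι : A e.ι = B e.ι) (hτ : A e.τ = B e.τ)
    (hν : ∀ i j, mink (A (e.ν i)) (e.ν j) = mink (B (e.ν i)) (e.ν j)) : A = B := by
  have hcol {v : Mink n} (hv : A v = B v) (x : Mink n) : mink v (A x) = mink v (B x) := by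
    rw [← neg_inj, ← hA, ← hB, hv]
  refine e.ext_endM hn ho hι hτ fun i => e.pairing_injective hn ?_
  simp only [pairing, LinearMap.coe_mk, AddHom.coe_mk, hcol ho, hcol hι, hcol hτ,
    mink_comm (e.ν _), hν]

theorem mink_comb_comb (a b d a' b' d' : ℝ) (k k' : Fin (n - 1) → ℝ) :
    mink (e.comb a b d k) (e.comb a' b' d' k') = -(a * b') - b * a' + d * d' + ∑ i, k i * k' i := by
  conv_lhs => rw [comb]
  simp only [mink_add_left, mink_smul_left, mink_sum_left, mink_o_comb, mink_ι_comb, mink_τ_comb,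
    mink_ν_comb]
  ring

theorem mink_eq_sum (hn : 1 ≤ n) (x y : Mink n) :
    mink x y = -(mink e.ι x * mink e.o y) - mink e.o x * mink e.ι y + mink e.τ x * mink e.τ y +
      ∑ i, mink (e.ν i) x * mink (e.ν i) y := by
  conv_lhs => rw [e.eq_comb hn x, e.eq_comb hn y, mink_comb_comb]
  ring

/-- The transformation which maps the pseudo-orthonormal basis `e` to `e'`. -/
def toFrame : EndM n :=
  LinearMap.toContinuousLinearMap
    { toFun := fun x =>
        e'.comb (-mink e.ι x) (-mink e.o x) (mink e.τ x) fun i => mink (e.ν i) x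
      map_add' := fun x y => by
        simp only [comb, mink_add_right, add_smul, Finset.sum_add_distrib]
        module
      map_smul' := fun r x => by
        simp only [comb, mink_smul_right, RingHom.id_apply, smul_add, Finset.smul_sum, mul_smul]
        module }

theorem toFrame_apply (x : Mink n) : e.toFrame e' x =
    e'.comb (-mink e.ι x) (-mink e.o x) (mink e.τ x) fun i => mink (e.ν i) x := rfl

theorem isLorentz_toFrame (hn : 1 ≤ n) : IsLorentz (e.toFrame e') := fun x y => by
  rw [toFrame_apply, toFrame_apply, mink_comb_comb, e.mink_eq_sum hn x y]
  ring

theorem toFrame_o : e.toFrame e' e.o = e'.o := by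
  simp [toFrame_apply, comb, e.o_o, mink_comm e.ι e.o, e.o_ι, mink_comm e.τ e.o, e.o_τ,
    mink_comm (e.ν _) e.o, e.o_ν]

theorem toFrame_ι : e.toFrame e' e.ι = e'.ι := by
  simp [toFrame_apply, comb, e.ι_ι, e.o_ι, mink_comm e.τ e.ι, e.ι_τ, mink_comm (e.ν _) e.ι, e.ι_ν]

theorem toFrame_τ : e.toFrame e' e.τ = e'.τ := by
  simp [toFrame_apply, comb, e.ι_τ, e.o_τ, e.τ_τ, mink_comm (e.ν _) e.τ, e.τ_ν]

/-- The image of a pseudo-orthonormal basis under an orthogonal transformation. -/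
def map {A : EndM n} (hA : IsLorentz A) : PseudoBasis n where
  o := A e.o
  ι := A e.ι
  τ := A e.τ
  ν i := A (e.ν i)
  o_o := (hA _ _).trans e.o_o
  ι_ι := (hA _ _).trans e.ι_ι
  o_ι := (hA _ _).trans e.o_ι
  τ_τ := (hA _ _).trans e.τ_τ
  o_τ := (hA _ _).trans e.o_τ
  ι_τ := (hA _ _).trans e.ι_τ
  o_ν i := (hA _ _).trans (e.o_ν i)
  ι_ν i := (hA _ _).trans (e.ι_ν i)
  τ_ν i := (hA _ _).trans (e.τ_ν i)
  ν_ν i j := (hA _ _).trans (e.ν_ν i j)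

theorem o_ne_zero : e.o ≠ 0 := fun h => by
  have := e.o_ι
  rw [h, mink_zero_left] at this
  norm_num at this

theorem norm_le_of_orthogonal (hn : 1 ≤ n) {x : Mink n} (ho : mink e.o x = 0)
    (hι : mink e.ι x = 0) : ‖x‖ ≤ √(mink x x) * (‖e.τ‖ + ∑ i, ‖e.ν i‖) := by
  have hxx : mink x x = mink e.τ x ^ 2 + ∑ i, mink (e.ν i) x ^ 2 := by
    simp only [e.mink_eq_sum hn x x, ho, hι, sq, mul_zero, neg_zero, sub_zero, zero_add]
  have hτ : |mink e.τ x| ≤ √(mink x x) := Real.abs_le_sqrt <| by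
    rw [hxx]
    exact le_add_of_nonneg_right (Finset.sum_nonneg fun i _ => sq_nonneg _)
  have hν (i) : |mink (e.ν i) x| ≤ √(mink x x) := Real.abs_le_sqrt <| by
    rw [hxx]
    exact (Finset.single_le_sum (f := fun i => mink (e.ν i) x ^ 2) (fun i _ => sq_nonneg _)
      (Finset.mem_univ i)).trans (le_add_of_nonneg_left (sq_nonneg _))
  calc ‖x‖ = ‖mink e.τ x • e.τ + ∑ i, mink (e.ν i) x • e.ν i‖ := by
        conv_lhs => rw [e.eq_comb hn x]
        simp only [comb, ho, hι, neg_zero, zero_smul, zero_add]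
    _ ≤ ‖mink e.τ x • e.τ‖ + ∑ i, ‖mink (e.ν i) x • e.ν i‖ :=
      (norm_add_le _ _).trans (add_le_add_right (norm_sum_le _ _) _)
    _ ≤ √(mink x x) * ‖e.τ‖ + ∑ i, √(mink x x) * ‖e.ν i‖ := by
      simp only [norm_smul, Real.norm_eq_abs]
      gcongr with i
      exact hν i
    _ = _ := by rw [mul_add, Finset.mul_sum]

end PseudoBasis

theorem exists_orthonormal_family {V : Type*} [AddCommGroup V] [Module ℝ V] [FiniteDimensional ℝ V]
    {d : ℕ} (hd : Module.finrank ℝ V = d) {B : LinearMap.BilinForm ℝ V} (hB : LinearMap.IsSymm B)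
    (hpos : ∀ x, x ≠ 0 → 0 < B x x) :
    ∃ v : Fin d → V, ∀ i j, B (v i) (v j) = if i = j then 1 else 0 := by
  subst hd
  obtain ⟨v, hv⟩ := LinearMap.BilinForm.exists_orthogonal_basis hB
  refine ⟨fun i => (√(B (v i) (v i)))⁻¹ • v i, fun i j => ?_⟩
  simp only [map_smul, LinearMap.smul_apply, smul_eq_mul]
  split_ifs with hij
  · subst hij
    have h := hpos (v i) (v.ne_zero i)
    rw [← mul_assoc, ← mul_inv, Real.mul_self_sqrt h.le, inv_mul_cancel₀ h.ne']
  · rw [show B (v i) (v j) = 0 from hv hij, mul_zero, mul_zero]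

theorem exists_pseudoBasis (hn : 1 ≤ n) {o ι τ : Mink n} (hoo : mink o o = 0)
    (hιι : mink ι ι = 0) (hoι : mink o ι = -1) (hττ : mink τ τ = 1) (hoτ : mink o τ = 0)
    (hιτ : mink ι τ = 0) :
    ∃ e : PseudoBasis n, e.o = o ∧ e.ι = ι ∧ e.τ = τ := by
  let P : Mink n →ₗ[ℝ] ℝ × ℝ × ℝ :=
    (minkForm n o).toLinearMap.prod ((minkForm n ι).toLinearMap.prod (minkForm n τ).toLinearMap)
  have hP_apply (x : Mink n) : P x = (mink o x, mink ι x, mink τ x) := rfl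
  have hP : Function.Surjective P := by
    rintro ⟨a, b, d⟩
    refine ⟨(-b) • o + (-a) • ι + d • τ, ?_⟩
    simp only [hP_apply, mink_add_right, mink_smul_right, hoo, hιι, hoι, hττ, hoτ, hιτ,
      mink_comm ι o, mink_comm τ o, mink_comm τ ι]
    ring_nf
  have hrank : Module.finrank ℝ (LinearMap.ker P) = n - 1 := by
    have h := LinearMap.finrank_range_add_finrank_ker P
    rw [LinearMap.range_eq_top.2 hP, finrank_top] at h
    simp only [Module.finrank_prod, Module.finrank_self, finrank_euclideanSpace_fin] at h
    omega
  have hker (x : LinearMap.ker P) : mink o x = 0 ∧ mink ι x = 0 ∧ mink τ x = 0 := by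
    simpa only [hP_apply, Prod.mk_eq_zero] using LinearMap.mem_ker.1 x.2
  have hpos (x : LinearMap.ker P) (hx : x ≠ 0) : 0 < mink (x : Mink n) x := by
    refine mink_self_pos_of_orthogonal (u := o + ι) ?_ ?_ (by simpa using hx)
    · simp only [mink_add_right, mink_add_left, hoo, hιι, hoι, mink_comm ι o]
      norm_num
    · rw [mink_add_left, (hker x).1, (hker x).2.1, add_zero]
  obtain ⟨v, hv⟩ := exists_orthonormal_family hrank
    (B := (minkForm n).toBilinForm.restrict (LinearMap.ker P)) ⟨fun x y => mink_comm _ _⟩ hpos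
  exact ⟨⟨o, ι, τ, fun i => v i, hoo, hιι, hoι, hττ, hoτ, hιτ, fun i => (hker (v i)).1,
    fun i => (hker (v i)).2.1, fun i => (hker (v i)).2.2, hv⟩, rfl, rfl, rfl⟩

theorem PseudoBasis.exists_isLorentz (e : PseudoBasis n) (hn : 1 ≤ n) {o ι τ : Mink n}
    (hoo : mink o o = 0) (hιι : mink ι ι = 0) (hoι : mink o ι = -1) (hττ : mink τ τ = 1)
    (hoτ : mink o τ = 0) (hιτ : mink ι τ = 0) :
    ∃ A : EndM n, IsLorentz A ∧ A e.o = o ∧ A e.ι = ι ∧ A e.τ = τ := by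
  obtain ⟨e', rfl, rfl, rfl⟩ := exists_pseudoBasis hn hoo hιι hoι hττ hoτ hιτ
  exact ⟨e.toFrame e', e.isLorentz_toFrame e' hn, e.toFrame_o e', e.toFrame_ι e', e.toFrame_τ e'⟩

end PseudoBasis

/-! ### Primitives -/

section Primitive

variable {n : ℕ} {b p : ℝ}

theorem eq_of_hasDerivAt_zero {E : Type*} [NormedAddCommGroup E] [NormedSpace ℝ E] {I : Set ℝ}
    (hI : IsOpen I) (hIc : IsPreconnected I) {f : ℝ → E} (hf : ∀ t ∈ I, HasDerivAt f 0 t) {t u : ℝ}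
    (ht : t ∈ I) (hu : u ∈ I) : f t = f u :=
  hI.is_const_of_deriv_eq_zero hIc
    (fun x hx => (hf x hx).differentiableAt.differentiableWithinAt)
    (fun x hx => (hf x hx).deriv) ht hu

theorem isLorentz_of_hasDerivAt {I : Set ℝ} (hI : IsOpen I) (hIc : IsPreconnected I)
    {G Ψ : ℝ → EndM n} (hG : ∀ t ∈ I, HasDerivAt G (G t * Ψ t) t) (hΨ : ∀ t ∈ I, IsSkew (Ψ t))
    (hp : p ∈ I) (hGp : IsLorentz (G p)) {t : ℝ} (ht : t ∈ I) : IsLorentz (G t) := by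
  have hd (u) (hu : u ∈ I) : HasDerivAt (fun u => G u * minkAdjoint (G u)) 0 u := by
    refine ((hG u hu).mul (hasDerivAt_minkAdjoint (hG u hu))).congr_deriv ?_
    rw [minkAdjoint_mul, (hΨ u hu).adjoint_eq]
    noncomm_ring
  have h : G t * minkAdjoint (G t) = 1 := by
    rw [eq_of_hasDerivAt_zero hI hIc hd ht hp, hGp.mul_adjoint_self]
  exact isLorentz_iff.2 (mul_eq_one_comm_of_finiteDimensional.1 h)

theorem IsPrimitive.isLorentz {Ψ G : ℝ → EndM n} (hp : p ∈ Ioo 0 b)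
    (hΨ : ∀ t ∈ Ioo 0 b, IsSkew (Ψ t)) (hG : IsPrimitive b Ψ p G) {t : ℝ} (ht : t ∈ Ioo 0 b) :
    IsLorentz (G t) :=
  isLorentz_of_hasDerivAt isOpen_Ioo isPreconnected_Ioo hG.2 hΨ hp
    (by rw [hG.1]; exact fun _ _ => rfl) ht

theorem exists_isLorentz_solution {B : ℝ → EndM n} (hB : ContinuousOn B (Ioo 0 b))
    (hskew : ∀ t ∈ Ioo 0 b, IsSkew (B t)) (hp : p ∈ Ioo 0 b) {F₀ : EndM n} (hF₀ : IsLorentz F₀) :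
    ∃ F : ℝ → EndM n, (∀ t ∈ Ioo 0 b, IsLorentz (F t) ∧ HasDerivAt F (B t * F t) t) ∧
      ∀ (a : Mink n) (x : ℝ → Mink n), (∀ t ∈ Ioo 0 b, HasDerivAt x (B t (x t)) t) → F₀ a = x p →
        ∀ t ∈ Ioo 0 b, F t a = x t := by
  obtain ⟨G, hG⟩ := exists_isPrimitive hB.neg hp
  have hskew' (t) (ht : t ∈ Ioo 0 b) : IsSkew (-B t) := (hskew t ht).neg
  have hL (t) (ht : t ∈ Ioo 0 b) : IsLorentz (G t) := hG.isLorentz hp hskew' ht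
  refine ⟨fun t => minkAdjoint (G t) * F₀, fun t ht => ⟨(hL t ht).adjoint.mul hF₀, ?_⟩,
    fun a x hx ha t ht => ?_⟩
  · refine ((hasDerivAt_minkAdjoint (hG.2 t ht)).mul_const F₀).congr_deriv ?_
    rw [minkAdjoint_mul, Pi.neg_apply, (hskew' t ht).adjoint_eq, neg_neg, mul_assoc]
  · have hd (u) (hu : u ∈ Ioo 0 b) : HasDerivAt (fun u => G u (x u)) 0 u := by
      refine ((hG.2 u hu).clm_apply (hx u hu)).congr_deriv ?_
      rw [mul_apply_eq_comp, Pi.neg_apply, _root_.neg_apply, map_neg, neg_add_cancel]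
    have h : G t (x t) = F₀ a := by
      rw [eq_of_hasDerivAt_zero isOpen_Ioo isPreconnected_Ioo hd ht hp, hG.1, one_apply_eq_self, ha]
    rw [mul_apply_eq_comp, ← h, (hL t ht).adjoint_apply_apply]

theorem gauge_eq {g Ψ : ℝ → EndM n} {Z g' : EndM n} {t : ℝ} (hg : IsLorentz (g t))
    (hg' : HasDerivAt g g' t) (hZ : Ψ t * g t + g' = g t * Z) : gauge g Ψ t = Z := by
  rw [gauge, hg.inverse_eq, hg'.deriv, mul_assoc, ← mul_add, hZ, ← mul_assoc, hg.adjoint_mul_self,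
    one_mul]

theorem mul_gauge {g Ψ : ℝ → EndM n} {g' : EndM n} {t : ℝ} (hg : IsLorentz (g t))
    (hg' : HasDerivAt g g' t) : g t * gauge g Ψ t = Ψ t * g t + g' := by
  rw [gauge, hg.inverse_eq, hg'.deriv, mul_assoc, ← mul_add, ← mul_assoc, hg.mul_adjoint_self,
    one_mul]

theorem IsPrimitive.gauge_primitive {g g' Ψ G : ℝ → EndM n} (hp : p ∈ Ioo 0 b)
    (hG : IsPrimitive b Ψ p G) (hg : ∀ t ∈ Ioo 0 b, IsLorentz (g t))
    (hg' : ∀ t ∈ Ioo 0 b, HasDerivAt g (g' t) t) :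
    IsPrimitive b (gauge g Ψ) p fun t => minkAdjoint (g p) * G t * g t := by
  refine ⟨?_, fun t ht => ?_⟩
  · simp only [hG.1, mul_one, (hg p hp).adjoint_mul_self]
  · refine (((hG.2 t ht).const_mul (minkAdjoint (g p))).mul (hg' t ht)).congr_deriv ?_
    rw [mul_assoc _ (g t), mul_gauge (hg t ht) (hg' t ht)]
    noncomm_ring

theorem gam_symm {Ψ : ℝ → EndM n} (hΨ : ContinuousOn Ψ (Ioo 0 b))
    (hskew : ∀ t ∈ Ioo 0 b, IsSkew (Ψ t)) (hp : p ∈ Ioo 0 b) {t : ℝ} (ht : t ∈ Ioo 0 b) :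
    Gam b Ψ t p = minkAdjoint (Gam b Ψ p t) := by
  have hG := gam_spec hΨ hp
  have h : IsPrimitive b Ψ t fun u => minkAdjoint (Gam b Ψ p t) * Gam b Ψ p u :=
    ⟨(hG.isLorentz hp hskew ht).adjoint_mul_self, fun u hu => by
      simpa only [mul_assoc] using (hG.2 u hu).const_mul (minkAdjoint (Gam b Ψ p t))⟩
  simpa only [hG.1, mul_one] using (gam_spec hΨ ht).eqOn hΨ ht h hp

section GaugeBy

variable {Ξ : ℝ → EndM n} (hΞ : ContinuousOn Ξ (Ioo 0 b)) (hskew : ∀ t ∈ Ioo 0 b, IsSkew (Ξ t))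
  (hp : p ∈ Ioo 0 b) (hcomm : ∀ t ∈ Ioo 0 b, Commute (Gam b Ξ p t) (Ξ t))
include hΞ hskew hp hcomm

theorem gaugeBy_eq (Ψ : ℝ → EndM n) {t : ℝ} (ht : t ∈ Ioo 0 b) :
    gaugeBy b Ξ p Ψ t = Gam b Ξ p t * (Ψ t - Ξ t) * minkAdjoint (Gam b Ξ p t) := by
  have hE := (gam_spec hΞ hp).isLorentz hp hskew ht
  rw [gaugeBy, gam_symm hΞ hskew hp ht, mul_sub, sub_mul, (hcomm t ht).eq, mul_assoc (Ξ t),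
    hE.mul_adjoint_self, mul_one]

theorem IsPrimitive.mul_gam {Ψ G : ℝ → EndM n} (hG : IsPrimitive b (gaugeBy b Ξ p Ψ) p G) :
    IsPrimitive b Ψ p fun t => G t * Gam b Ξ p t := by
  have hE := gam_spec hΞ hp
  refine ⟨by simp only [hG.1, hE.1, one_mul], fun t ht => ?_⟩
  refine ((hG.2 t ht).mul (hE.2 t ht)).congr_deriv ?_
  calc G t * gaugeBy b Ξ p Ψ t * Gam b Ξ p t + G t * (Gam b Ξ p t * Ξ t)
      = G t * Gam b Ξ p t * (Ψ t - Ξ t) * (minkAdjoint (Gam b Ξ p t) * Gam b Ξ p t) +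
          G t * Gam b Ξ p t * Ξ t := by
        rw [gaugeBy_eq hΞ hskew hp hcomm Ψ ht]
        noncomm_ring
    _ = G t * Gam b Ξ p t * Ψ t := by
        rw [(hE.isLorentz hp hskew ht).adjoint_mul_self, mul_one, ← mul_add, sub_add_cancel]

theorem gam_mul_eq_mul_gam_mul_gam {g g' Ψ : ℝ → EndM n} (hΨ : ContinuousOn Ψ (Ioo 0 b))
    (hg : ∀ t ∈ Ioo 0 b, IsLorentz (g t)) (hg' : ∀ t ∈ Ioo 0 b, HasDerivAt g (g' t) t)
    (hgauge : ContinuousOn (gauge g Ψ) (Ioo 0 b))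
    (hΦ : ContinuousOn (gaugeBy b Ξ p (gauge g Ψ)) (Ioo 0 b)) {t : ℝ} (ht : t ∈ Ioo 0 b) :
    Gam b Ψ p t * g t = g p * (Gam b (gaugeBy b Ξ p (gauge g Ψ)) p t * Gam b Ξ p t) := by
  have heq : minkAdjoint (g p) * Gam b Ψ p t * g t =
      Gam b (gaugeBy b Ξ p (gauge g Ψ)) p t * Gam b Ξ p t :=
    ((gam_spec hΨ hp).gauge_primitive hp hg hg').eqOn hgauge hp
      ((gam_spec hΦ hp).mul_gam hΞ hskew hp hcomm) ht
  rw [← heq, ← mul_assoc, ← mul_assoc, (hg p hp).mul_adjoint_self, one_mul]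

end GaugeBy

theorem IsPrimitive.exists_tendsto {Φ G : ℝ → EndM n} {Φ₀ : EndM n} (hp : p ∈ Ioo 0 b)
    (hΦ : ContinuousOn Φ (Ioo 0 b)) (h₀ : Tendsto Φ (𝓝[>] 0) (𝓝 Φ₀)) (hG : IsPrimitive b Φ p G) :
    ∃ Γ₀, Tendsto G (𝓝[>] 0) (𝓝 Γ₀) := by
  have hb : 0 < b := hp.1.trans hp.2
  -- Shifted by `1`, the form extends continuously across the boundary point of the interval.
  let Ψ : ℝ → EndM n := fun t => extendFrom (Ioo 0 b) Φ (max (t - 1) 0)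
  have hΨ : ContinuousOn Ψ (Ioo 0 (b + 1)) :=
    (continuousOn_Ico_extendFrom_Ioo hΦ h₀).comp (f := fun t => max (t - 1) 0) (by fun_prop)
      fun t ht => ⟨le_max_right _ _, max_lt (by linarith [ht.2]) hb⟩
  have hΨΦ (t) (ht : t ∈ Ioo 0 b) : Ψ (t + 1) = Φ t := by
    simp only [Ψ, add_sub_cancel_right, max_eq_left ht.1.le]
    exact extendFrom_eq (subset_closure ht) ((hΦ t ht).tendsto)
  obtain ⟨H, hH⟩ := exists_isPrimitive hΨ (p := p + 1) ⟨by linarith [hp.1], by linarith [hp.2]⟩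
  have hH' : IsPrimitive b Φ p fun t => H (t + 1) := ⟨hH.1, fun t ht => by
    rw [← hΨΦ t ht]
    exact (hH.2 (t + 1) ⟨by linarith [ht.1], by linarith [ht.2]⟩).comp_add_const t 1⟩
  have hH₀ : ContinuousAt (fun t => H (t + 1)) 0 :=
    ((hH.2 (0 + 1) ⟨by linarith, by linarith⟩).comp_add_const 0 1).continuousAt
  refine ⟨H (0 + 1), (hH₀.tendsto.mono_left nhdsWithin_le_nhds).congr' ?_⟩
  filter_upwards [Ioo_mem_nhdsGT hb] with t ht using (hG.eqOn hΦ hp hH' ht).symm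

end Primitive

/-! ### The rotations generated by the pure pole form -/

section Rodrigues

variable {R : Type*} [NormedRing R] [NormedAlgebra ℝ R]

/-- Rodrigues' formula for the one-parameter group `u ↦ exp (u K)` when `K³ = -k² K`. -/
def rodrigues (K : R) (k u : ℝ) : R :=
  1 + (Real.sin (k * u) / k) • K + ((1 - Real.cos (k * u)) / k ^ 2) • (K * K)

variable (K : R) (k : ℝ)

theorem rodrigues_zero : rodrigues K k 0 = 1 := by
  simp only [rodrigues, mul_zero, Real.sin_zero, Real.cos_zero, sub_self, zero_div, zero_smul,
    add_zero]

theorem commute_rodrigues (u : ℝ) : Commute (rodrigues K k u) K :=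
  ((Commute.one_left K).add_left ((Commute.refl K).smul_left _)).add_left
    (((Commute.refl K).mul_left (Commute.refl K)).smul_left _)

variable {K k}

theorem hasDerivAt_rodrigues (hk : k ≠ 0) (hK : K * K * K = -k ^ 2 • K) (u : ℝ) :
    HasDerivAt (rodrigues K k) (rodrigues K k u * K) u := by
  have hlin : HasDerivAt (fun u => k * u) k u := by
    simpa only [id_eq, mul_one] using (hasDerivAt_id u).const_mul k
  have hsin := ((hlin.sin.div_const k).smul_const K).const_add 1
  have hcos := ((hlin.cos.const_sub 1).div_const (k ^ 2)).smul_const (K * K)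
  refine (hsin.add hcos).congr_deriv ?_
  simp only [rodrigues, add_mul, one_mul, smul_mul_assoc, hK, smul_smul]
  match_scalars <;> field_simp
  ring

theorem periodic_rodrigues (hk : k ≠ 0) : Function.Periodic (rodrigues K k) (2 * Real.pi / k) := by
  intro u
  simp only [rodrigues, mul_add, mul_div_cancel₀ _ hk, Real.sin_add_two_pi, Real.cos_add_two_pi]

end Rodrigues

section Rotation

variable {n : ℕ}

theorem wedge_mul_wedge_mul_wedge (v w : Mink n) : wedge v w * wedge v w * wedge v w =
    -(mink v v * mink w w - mink v w ^ 2) • wedge v w := by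
  ext1 x
  simp only [mul_apply_eq_comp, wedge_apply, map_sub, map_smul, mink_comm w v, _root_.smul_apply]
  module

/-- The generator `-(o - 𝔱) ∧ (ι - μ 𝔱)` of the pure pole form `ξ_μ`. -/
def poleGen (e : PseudoBasis n) (μ : ℝ) : EndM n :=
  -wedge (e.o - e.τ) (e.ι - μ • e.τ)

variable (e : PseudoBasis n) (μ : ℝ)

theorem poleForm_eq (s : ℝ → ℝ) (t : ℝ) :
    poleForm s e μ t = (deriv s t / s t) • poleGen e μ := by
  ext1 x
  simp only [poleForm, poleGen, _root_.smul_apply, _root_.neg_apply]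
  module

theorem isSkew_poleGen : IsSkew (poleGen e μ) := (isSkew_wedge _ _).neg

theorem poleGen_apply (x : Mink n) : poleGen e μ x =
    (mink e.ι x - μ * mink e.τ x) • (e.o - e.τ) - (mink e.o x - mink e.τ x) • (e.ι - μ • e.τ) := by
  simp only [poleGen, _root_.neg_apply, wedge_apply, mink_sub_left, mink_smul_left]
  module

theorem poleGen_o : poleGen e μ e.o = e.τ - e.o := by
  simp only [poleGen_apply, mink_comm e.ι e.o, mink_comm e.τ e.o, e.o_o, e.o_ι, e.o_τ]
  module

theorem poleGen_τ : poleGen e μ e.τ = e.ι - μ • e.o := by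
  simp only [poleGen_apply, e.ι_τ, e.o_τ, e.τ_τ]
  module

theorem poleGen_cube :
    poleGen e μ * poleGen e μ * poleGen e μ = -(2 * μ - 1) • poleGen e μ := by
  have hgram : mink (e.o - e.τ) (e.o - e.τ) * mink (e.ι - μ • e.τ) (e.ι - μ • e.τ) -
      mink (e.o - e.τ) (e.ι - μ • e.τ) ^ 2 = 2 * μ - 1 := by
    simp only [mink_sub_left, mink_sub_right, mink_smul_left, mink_smul_right, e.o_o, e.o_ι,
      e.o_τ, e.τ_τ, e.ι_τ, e.ι_ι, mink_comm e.τ e.o, mink_comm e.τ e.ι]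
    ring
  have h := wedge_mul_wedge_mul_wedge (e.o - e.τ) (e.ι - μ • e.τ)
  rw [hgram] at h
  calc poleGen e μ * poleGen e μ * poleGen e μ = -(wedge (e.o - e.τ) (e.ι - μ • e.τ) *
        wedge (e.o - e.τ) (e.ι - μ • e.τ) * wedge (e.o - e.τ) (e.ι - μ • e.τ)) := by
        rw [poleGen]
        noncomm_ring
    _ = -(2 * μ - 1) • poleGen e μ := by
        rw [h, poleGen, smul_neg]

/-- The angular velocity of the rotations generated by the pure pole form. -/
def poleFreq (μ : ℝ) : ℝ := √(2 * μ - 1)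

/-- The one-parameter group of rotations generated by the pure pole form. -/
def poleRot : ℝ → EndM n := rodrigues (poleGen e μ) (poleFreq μ)

theorem poleRot_o (u : ℝ) : poleRot e μ u e.o =
    e.o + (Real.sin (poleFreq μ * u) / poleFreq μ) • (e.τ - e.o) +
      ((1 - Real.cos (poleFreq μ * u)) / poleFreq μ ^ 2) •
        ((1 - μ) • e.o + e.ι - e.τ) := by
  change e.o + (Real.sin (poleFreq μ * u) / poleFreq μ) • poleGen e μ e.o +
    ((1 - Real.cos (poleFreq μ * u)) / poleFreq μ ^ 2) • poleGen e μ (poleGen e μ e.o) = _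
  simp only [poleGen_o, map_sub, poleGen_τ]
  module

theorem poleRot_o_mem (u : ℝ) :
    poleRot e μ u e.o ∈ Submodule.span ℝ {e.o, e.ι, e.τ} := by
  have ho : e.o ∈ Submodule.span ℝ {e.o, e.ι, e.τ} := Submodule.subset_span (by simp)
  have hι : e.ι ∈ Submodule.span ℝ {e.o, e.ι, e.τ} := Submodule.subset_span (by simp)
  have hτ : e.τ ∈ Submodule.span ℝ {e.o, e.ι, e.τ} := Submodule.subset_span (by simp)
  rw [poleRot_o]
  exact add_mem (add_mem ho (Submodule.smul_mem _ _ (sub_mem hτ ho)))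
    (Submodule.smul_mem _ _ (sub_mem (add_mem (Submodule.smul_mem _ _ ho) hι) hτ))

variable {μ}

theorem poleFreq_pos (hμ : 1 - 2 * μ < 0) : 0 < poleFreq μ :=
  Real.sqrt_pos.2 (by linarith)

theorem poleFreq_sq (hμ : 1 - 2 * μ < 0) : poleFreq μ ^ 2 = 2 * μ - 1 :=
  Real.sq_sqrt (by linarith)

theorem hasDerivAt_poleRot (hμ : 1 - 2 * μ < 0) (u : ℝ) :
    HasDerivAt (poleRot e μ) (poleRot e μ u * poleGen e μ) u :=
  hasDerivAt_rodrigues (poleFreq_pos hμ).ne' (by rw [poleGen_cube, ← poleFreq_sq hμ]) u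

theorem isLorentz_poleRot (hμ : 1 - 2 * μ < 0) (u : ℝ) : IsLorentz (poleRot e μ u) := by
  refine isLorentz_of_hasDerivAt isOpen_univ isPreconnected_univ (p := 0)
    (fun t _ => hasDerivAt_poleRot e hμ t) (fun _ _ => isSkew_poleGen e μ) (mem_univ _) ?_
    (mem_univ u)
  rw [poleRot, rodrigues_zero]
  exact fun _ _ => rfl

/-- The period of the rotations generated by the pure pole form. -/
def polePeriod (μ : ℝ) : ℝ := 2 * Real.pi / poleFreq μ

theorem polePeriod_pos (hμ : 1 - 2 * μ < 0) : 0 < polePeriod μ :=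
  div_pos Real.two_pi_pos (poleFreq_pos hμ)

theorem periodic_poleRot (hμ : 1 - 2 * μ < 0) : Function.Periodic (poleRot e μ) (polePeriod μ) :=
  periodic_rodrigues (poleFreq_pos hμ).ne'

theorem continuous_poleRot (hμ : 1 - 2 * μ < 0) : Continuous (poleRot e μ) :=
  continuous_iff_continuousAt.2 fun u => (hasDerivAt_poleRot e hμ u).continuousAt

theorem commute_poleRot_poleGen (u : ℝ) : Commute (poleRot e μ u) (poleGen e μ) :=
  commute_rodrigues _ _ u

/-- The points of the conic of null lines in `⟨o, ι, 𝔱⟩` in homogeneous coordinates `(α, β)`. -/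
def conicVec (α β : ℝ) : Mink n := α ^ 2 • e.o + (2 * α * β) • e.τ + (2 * β ^ 2) • e.ι

theorem exists_eq_smul_conicVec {x : Mink n} (hx : x ∈ Submodule.span ℝ {e.o, e.ι, e.τ})
    (hxx : mink x x = 0) : ∃ r α β : ℝ, x = r • conicVec e α β := by
  obtain ⟨a, y, hy, rfl⟩ := Submodule.mem_span_insert.1 hx
  obtain ⟨b, d, rfl⟩ := Submodule.mem_span_pair.1 hy
  have hnull : d ^ 2 = 2 * a * b := by
    simp only [mink_add_left, mink_add_right, mink_smul_left, mink_smul_right, e.o_o, e.o_ι,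
      e.o_τ, e.τ_τ, e.ι_τ, e.ι_ι, mink_comm e.τ e.o, mink_comm e.τ e.ι, mink_comm e.ι e.o] at hxx
    linarith
  rcases eq_or_ne a 0 with rfl | ha
  · have hd : d = 0 := by simpa using hnull
    refine ⟨b / 2, 0, 1, ?_⟩
    rw [conicVec, hd]
    module
  · have hb : b = d ^ 2 / (2 * a) := by
      field_simp
      linarith
    refine ⟨a, 1, d / (2 * a), ?_⟩
    rw [conicVec, hb]
    match_scalars <;> field_simp

theorem conicVec_poleFreq (hμ : 1 - 2 * μ < 0) (ρ φ : ℝ) :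
    conicVec e (ρ * (poleFreq μ * Real.cos φ - Real.sin φ)) (ρ * Real.sin φ) =
      (ρ ^ 2 * poleFreq μ ^ 2) • poleRot e μ (2 * φ / poleFreq μ) e.o := by
  have hk := (poleFreq_pos hμ).ne'
  have hk2 := poleFreq_sq hμ
  have hsc := Real.cos_sq' φ
  rw [poleRot_o, conicVec, mul_div_cancel₀ _ hk, Real.sin_two_mul, Real.cos_two_mul]
  set k := poleFreq μ
  match_scalars <;> field_simp
  · linear_combination ρ ^ 2 * ((k ^ 2 + 2 * (1 - μ)) * hsc - Real.sin φ ^ 2 * hk2)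
  · linear_combination -2 * ρ ^ 2 * hsc
  · linear_combination 2 * ρ ^ 2 * hsc

theorem exists_smul_poleRot_o_eq (hμ : 1 - 2 * μ < 0) {x : Mink n}
    (hx : x ∈ Submodule.span ℝ {e.o, e.ι, e.τ}) (hx₀ : x ≠ 0) (hxx : mink x x = 0) :
    ∃ u r : ℝ, r ≠ 0 ∧ x = r • poleRot e μ u e.o := by
  obtain ⟨r, α, β, rfl⟩ := exists_eq_smul_conicVec e hx hxx
  have hk := (poleFreq_pos hμ).ne'
  set z : ℂ := ⟨(α + β) / poleFreq μ, β⟩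
  have hβ : β = ‖z‖ * Real.sin z.arg := (Complex.norm_mul_sin_arg z).symm
  have hα : α = ‖z‖ * (poleFreq μ * Real.cos z.arg - Real.sin z.arg) := by
    have hre : ‖z‖ * Real.cos z.arg = (α + β) / poleFreq μ := Complex.norm_mul_cos_arg z
    rw [mul_sub, ← hβ, mul_left_comm, hre]
    field_simp
    ring
  have h : r • conicVec e α β =
      (r * (‖z‖ ^ 2 * poleFreq μ ^ 2)) • poleRot e μ (2 * z.arg / poleFreq μ) e.o := by
    conv_lhs => rw [hα, hβ, conicVec_poleFreq e hμ, smul_smul]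
  refine ⟨_, _, fun hr => hx₀ ?_, h⟩
  rw [h, hr, zero_smul]

end Rotation

/-! ### The flat lift and its moving frame -/

section FlatLift

variable {E : Type*} [NormedAddCommGroup E] [NormedSpace ℝ E] {I : Set ℝ} {t : ℝ}

theorem hasDerivAt_of_contDiffOn {f : ℝ → E} (hf : ContDiffOn ℝ ∞ f I) (hI : IsOpen I)
    (ht : t ∈ I) : HasDerivAt f (deriv f t) t :=
  ((hf.differentiableOn (by simp)).differentiableAt (hI.mem_nhds ht)).hasDerivAt

theorem contDiffOn_deriv {f : ℝ → E} (hf : ContDiffOn ℝ ∞ f I) (hI : IsOpen I) :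
    ContDiffOn ℝ ∞ (deriv f) I :=
  ((contDiffOn_infty_iff_deriv_of_isOpen hI).1 hf).2

/-- The derivative `dx/ds` of `x` with respect to the parameter `s`. -/
def paramDeriv (s : ℝ → ℝ) (x : ℝ → E) (t : ℝ) : E := (deriv s t)⁻¹ • deriv x t

theorem contDiffOn_paramDeriv {s : ℝ → ℝ} {x : ℝ → E} (hI : IsOpen I) (hs : ContDiffOn ℝ ∞ s I)
    (hs' : ∀ t ∈ I, deriv s t ≠ 0) (hx : ContDiffOn ℝ ∞ x I) :
    ContDiffOn ℝ ∞ (paramDeriv s x) I :=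
  ((contDiffOn_deriv hs hI).inv hs').smul (contDiffOn_deriv hx hI)

variable {n : ℕ} {c : ℝ → Mink n} {s : ℝ → ℝ}

theorem mink_paramDeriv_add_eq_zero {x y : ℝ → Mink n} {k : ℝ} (hx : DifferentiableAt ℝ x t)
    (hy : DifferentiableAt ℝ y t) (h : ∀ᶠ u in 𝓝 t, mink (x u) (y u) = k) :
    mink (paramDeriv s x t) (y t) + mink (x t) (paramDeriv s y t) = 0 := by
  have hk := (hasDerivAt_mink hx.hasDerivAt hy.hasDerivAt).unique
    ((hasDerivAt_const t k).congr_of_eventuallyEq h)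
  rw [paramDeriv, paramDeriv, mink_smul_left, mink_smul_right, ← mul_add, hk, mul_zero]

/-- `c` is a light cone lift of a regular curve and `s` a regular parameter on the open set `I`. -/
structure IsParamCurve (c : ℝ → Mink n) (s : ℝ → ℝ) (I : Set ℝ) : Prop where
  isOpen : IsOpen I
  lift : IsRegularLift c I
  smooth : ContDiffOn ℝ ∞ s I
  deriv_pos : ∀ t ∈ I, 0 < deriv s t

variable (c s)

/-- The unit tangent field `df/ds` of the flat lift `f`. -/
def flatTangent : ℝ → Mink n := paramDeriv s (flatLift c s)

/-- The second derivative `d²f/ds²` of the flat lift `f`. -/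
def flatAccel : ℝ → Mink n := paramDeriv s (flatTangent c s)

/-- The null vector `f̄` in the span of `f`, `df/ds` and `d²f/ds²`, orthogonal to `df/ds`, with
`⟨f, f̄⟩ = -1`. -/
def flatDual (t : ℝ) : Mink n :=
  flatAccel c s t + (mink (flatAccel c s t) (flatAccel c s t) / 2) • flatLift c s t

/-- The form `ds (df/ds ∧ f̄ - f ∧ df̄/ds)`, by which the frames of the flat lift evolve. -/
def frameForm (t : ℝ) : EndM n :=
  deriv s t • (wedge (flatTangent c s t) (flatDual c s t) -
    wedge (flatLift c s t) (paramDeriv s (flatDual c s) t))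

variable {c s}

theorem isSkew_frameForm : IsSkew (frameForm c s t) :=
  ((isSkew_wedge _ _).sub (isSkew_wedge _ _)).smul _

theorem frameForm_apply (x : Mink n) : frameForm c s t x = deriv s t •
    (mink (flatTangent c s t) x • flatDual c s t - mink (flatDual c s t) x • flatTangent c s t -
      (mink (flatLift c s t) x • paramDeriv s (flatDual c s) t -
        mink (paramDeriv s (flatDual c s) t) x • flatLift c s t)) := rfl

namespace IsParamCurve

variable (h : IsParamCurve c s I)

include h

theorem contDiffOn_scale :
    ContDiffOn ℝ ∞ (fun t => deriv s t / √(mink (deriv c t) (deriv c t))) I := by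
  have hc' := contDiffOn_deriv h.lift.1 h.isOpen
  refine (contDiffOn_deriv h.smooth h.isOpen).div
    ((contDiffOn_mink hc' hc').sqrt fun t ht => (h.lift.2 t ht).2.2.ne') ?_
  exact fun t ht => (Real.sqrt_pos.2 (h.lift.2 t ht).2.2).ne'

theorem contDiffOn_flatLift : ContDiffOn ℝ ∞ (flatLift c s) I := h.contDiffOn_scale.smul h.lift.1

theorem contDiffOn_paramDeriv {x : ℝ → E} (hx : ContDiffOn ℝ ∞ x I) :
    ContDiffOn ℝ ∞ (paramDeriv s x) I :=
  Calapso.contDiffOn_paramDeriv h.isOpen h.smooth (fun t ht => (h.deriv_pos t ht).ne') hx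

theorem contDiffOn_flatTangent : ContDiffOn ℝ ∞ (flatTangent c s) I :=
  h.contDiffOn_paramDeriv h.contDiffOn_flatLift

theorem contDiffOn_flatAccel : ContDiffOn ℝ ∞ (flatAccel c s) I :=
  h.contDiffOn_paramDeriv h.contDiffOn_flatTangent

theorem contDiffOn_flatDual : ContDiffOn ℝ ∞ (flatDual c s) I :=
  h.contDiffOn_flatAccel.add
    (((contDiffOn_mink h.contDiffOn_flatAccel h.contDiffOn_flatAccel).div_const 2).smul
      h.contDiffOn_flatLift)

theorem contDiffOn_frameForm : ContDiffOn ℝ ∞ (frameForm c s) I :=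
  (contDiffOn_deriv h.smooth h.isOpen).smul
    ((contDiffOn_wedge h.contDiffOn_flatTangent h.contDiffOn_flatDual).sub
      (contDiffOn_wedge h.contDiffOn_flatLift (h.contDiffOn_paramDeriv h.contDiffOn_flatDual)))

variable (ht : t ∈ I)

include ht

theorem hasDerivAt {x : ℝ → E} (hx : ContDiffOn ℝ ∞ x I) :
    HasDerivAt x (deriv s t • paramDeriv s x t) t := by
  rw [paramDeriv, smul_inv_smul₀ (h.deriv_pos t ht).ne']
  exact hasDerivAt_of_contDiffOn hx h.isOpen ht

theorem mink_paramDeriv_add_eq_zero {x y : ℝ → Mink n} {k : ℝ} (hx : ContDiffOn ℝ ∞ x I)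
    (hy : ContDiffOn ℝ ∞ y I) (hxy : ∀ u ∈ I, mink (x u) (y u) = k) :
    mink (paramDeriv s x t) (y t) + mink (x t) (paramDeriv s y t) = 0 :=
  Calapso.mink_paramDeriv_add_eq_zero (h.hasDerivAt ht hx).differentiableAt
    (h.hasDerivAt ht hy).differentiableAt
    (Filter.mem_of_superset (h.isOpen.mem_nhds ht) hxy)

theorem mink_paramDeriv_self {x : ℝ → Mink n} {k : ℝ} (hx : ContDiffOn ℝ ∞ x I)
    (hxx : ∀ u ∈ I, mink (x u) (x u) = k) : mink (x t) (paramDeriv s x t) = 0 := by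
  have hk := h.mink_paramDeriv_add_eq_zero ht hx hx hxx
  rw [mink_comm] at hk
  linarith

theorem mink_flatLift_flatLift : mink (flatLift c s t) (flatLift c s t) = 0 := by
  rw [flatLift, mink_smul_left, mink_smul_right, (h.lift.2 t ht).2.1, mul_zero, mul_zero]

theorem mink_flatLift_flatTangent : mink (flatLift c s t) (flatTangent c s t) = 0 :=
  h.mink_paramDeriv_self ht h.contDiffOn_flatLift fun _ hu => h.mink_flatLift_flatLift hu

theorem exists_flatTangent_eq : ∃ r : ℝ,
    flatTangent c s t = r • c t + (√(mink (deriv c t) (deriv c t)))⁻¹ • deriv c t := by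
  have hscale := hasDerivAt_of_contDiffOn h.contDiffOn_scale h.isOpen ht
  have hf := (hscale.smul (hasDerivAt_of_contDiffOn h.lift.1 h.isOpen ht)).deriv
  refine ⟨(deriv s t)⁻¹ * deriv (fun t => deriv s t / √(mink (deriv c t) (deriv c t))) t, ?_⟩
  refine (congrArg ((deriv s t)⁻¹ • ·) (hf.trans (add_comm _ _))).trans ?_
  simp only [smul_add, smul_smul, div_eq_mul_inv, inv_mul_cancel_left₀ (h.deriv_pos t ht).ne']

theorem mink_flatTangent_flatTangent : mink (flatTangent c s t) (flatTangent c s t) = 1 := by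
  obtain ⟨r, hr⟩ := h.exists_flatTangent_eq ht
  have hcc' : mink (c t) (deriv c t) = 0 := by
    have hc := h.mink_paramDeriv_self ht h.lift.1 fun u hu => (h.lift.2 u hu).2.1
    rw [paramDeriv, mink_smul_right] at hc
    exact (mul_eq_zero.1 hc).resolve_left (inv_ne_zero (h.deriv_pos t ht).ne')
  have hpos := (h.lift.2 t ht).2.2
  rw [hr]
  simp only [mink_smul_left, mink_smul_right, mink_add_left, mink_add_right, hcc',
    mink_comm (deriv c t) (c t), (h.lift.2 t ht).2.1, mul_zero, add_zero, zero_add]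
  rw [← mul_assoc, ← mul_inv, Real.mul_self_sqrt hpos.le, inv_mul_cancel₀ hpos.ne']

theorem mink_flatTangent_flatAccel : mink (flatTangent c s t) (flatAccel c s t) = 0 :=
  h.mink_paramDeriv_self ht h.contDiffOn_flatTangent fun _ hu => h.mink_flatTangent_flatTangent hu

theorem mink_flatLift_flatAccel : mink (flatLift c s t) (flatAccel c s t) = -1 := by
  have hk := h.mink_paramDeriv_add_eq_zero ht h.contDiffOn_flatLift h.contDiffOn_flatTangent
    fun u hu => h.mink_flatLift_flatTangent hu
  rw [← flatTangent, h.mink_flatTangent_flatTangent ht] at hk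
  exact eq_neg_of_add_eq_zero_right hk

theorem mink_flatLift_flatDual : mink (flatLift c s t) (flatDual c s t) = -1 := by
  rw [flatDual, mink_add_right, mink_smul_right, h.mink_flatLift_flatAccel ht,
    h.mink_flatLift_flatLift ht, mul_zero, add_zero]

theorem mink_flatTangent_flatDual : mink (flatTangent c s t) (flatDual c s t) = 0 := by
  rw [flatDual, mink_add_right, mink_smul_right, h.mink_flatTangent_flatAccel ht,
    mink_comm _ (flatLift c s t), h.mink_flatLift_flatTangent ht, mul_zero, add_zero]

theorem mink_flatDual_flatDual : mink (flatDual c s t) (flatDual c s t) = 0 := by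
  simp only [flatDual, mink_add_left, mink_add_right, mink_smul_left, mink_smul_right,
    h.mink_flatLift_flatAccel ht, mink_comm (flatAccel c s t) (flatLift c s t),
    h.mink_flatLift_flatLift ht]
  ring

theorem mink_flatLift_deriv_flatDual :
    mink (flatLift c s t) (paramDeriv s (flatDual c s) t) = 0 := by
  have hk := h.mink_paramDeriv_add_eq_zero ht h.contDiffOn_flatLift h.contDiffOn_flatDual
    fun u hu => h.mink_flatLift_flatDual hu
  rwa [← flatTangent, h.mink_flatTangent_flatDual ht, zero_add] at hk

theorem mink_flatDual_deriv_flatDual :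
    mink (flatDual c s t) (paramDeriv s (flatDual c s) t) = 0 :=
  h.mink_paramDeriv_self ht h.contDiffOn_flatDual fun _ hu => h.mink_flatDual_flatDual hu

theorem mink_flatTangent_deriv_flatDual :
    mink (paramDeriv s (flatDual c s) t) (flatTangent c s t) =
      -(mink (flatAccel c s t) (flatAccel c s t) / 2) := by
  have hk := h.mink_paramDeriv_add_eq_zero ht h.contDiffOn_flatDual h.contDiffOn_flatTangent
    fun u hu => (mink_comm _ _).trans (h.mink_flatTangent_flatDual hu)
  rw [← flatAccel, flatDual, mink_add_left, mink_smul_left, h.mink_flatLift_flatAccel ht] at hk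
  linarith

theorem frameForm_flatLift :
    frameForm c s t (flatLift c s t) = deriv s t • flatTangent c s t := by
  simp only [frameForm_apply, mink_comm _ (flatLift c s t), h.mink_flatLift_flatTangent ht,
    h.mink_flatLift_flatDual ht, h.mink_flatLift_flatLift ht, h.mink_flatLift_deriv_flatDual ht]
  module

theorem frameForm_flatDual :
    frameForm c s t (flatDual c s t) = deriv s t • paramDeriv s (flatDual c s) t := by
  simp only [frameForm_apply, h.mink_flatTangent_flatDual ht, h.mink_flatLift_flatDual ht,
    h.mink_flatDual_flatDual ht, mink_comm _ (flatDual c s t), h.mink_flatDual_deriv_flatDual ht]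
  module

theorem frameForm_flatTangent :
    frameForm c s t (flatTangent c s t) = deriv s t • flatAccel c s t := by
  simp only [frameForm_apply, h.mink_flatTangent_flatTangent ht, h.mink_flatLift_flatTangent ht,
    mink_comm (flatDual c s t), h.mink_flatTangent_flatDual ht,
    h.mink_flatTangent_deriv_flatDual ht]
  rw [flatDual]
  module

theorem assocForm_eq (Q : ℝ → ℝ) :
    assocForm c Q t = (Q t / deriv s t) • wedge (flatLift c s t) (flatTangent c s t) := by
  obtain ⟨r, hr⟩ := h.exists_flatTangent_eq ht
  have hs := (h.deriv_pos t ht).ne'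
  have hpos := (h.lift.2 t ht).2.2
  have hsq := Real.sq_sqrt hpos.le
  have hne := (Real.sqrt_pos.2 hpos).ne'
  rw [hr, flatLift, wedge_smul_left, wedge_add_right, wedge_smul_right, wedge_smul_right,
    wedge_self]
  ext1 x
  simp only [assocForm, _root_.smul_apply, smul_zero, zero_add, smul_smul]
  congr 1
  field_simp
  rw [hsq]

end IsParamCurve

end FlatLift

/-! ### Curve frames and the singular frame -/

section Frames

theorem contDiffOn_of_linear_ode {𝔸 : Type*} [NormedRing 𝔸] [NormedAlgebra ℝ 𝔸] {U : Set ℝ}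
    (hU : IsOpen U) {B F : ℝ → 𝔸} (hB : ContDiffOn ℝ ∞ B U)
    (hF : ∀ t ∈ U, HasDerivAt F (B t * F t) t) : ContDiffOn ℝ ∞ F U := by
  have hd : DifferentiableOn ℝ F U := fun t ht => (hF t ht).differentiableAt.differentiableWithinAt
  refine contDiffOn_infty.2 fun m => ?_
  induction m with
  | zero => exact contDiffOn_zero.2 hd.continuousOn
  | succ m ih =>
    push_cast
    refine (contDiffOn_succ_iff_deriv_of_isOpen hU).2
      ⟨hd, fun h => absurd h WithTop.coe_ne_top, ?_⟩
    exact ((hB.of_le (by exact_mod_cast le_top)).mul ih).congr fun t ht => (hF t ht).deriv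

variable {n : ℕ} {b p : ℝ} {c : ℝ → Mink n} {s : ℝ → ℝ} {t : ℝ}

theorem IsParamCurve.mono {I J : Set ℝ} (h : IsParamCurve c s I) (hJ : IsOpen J) (hJI : J ⊆ I) :
    IsParamCurve c s J :=
  ⟨hJ, ⟨h.lift.1.mono hJI, fun t ht => h.lift.2 t (hJI ht)⟩, h.smooth.mono hJI,
    fun t ht => h.deriv_pos t (hJI ht)⟩

theorem frameForm_apply_of_orthogonal {x : Mink n} (hf : mink (flatLift c s t) x = 0)
    (hT : mink (flatTangent c s t) x = 0) (hd : mink (flatDual c s t) x = 0) :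
    frameForm c s t x =
      (deriv s t * mink (paramDeriv s (flatDual c s) t) x) • flatLift c s t := by
  rw [frameForm_apply, hf, hT, hd]
  module

theorem deriv_apply {F : ℝ → EndM n} {F' : EndM n} (hF : HasDerivAt F F' t) (x : Mink n) :
    deriv (fun u => F u x) t = F' x := by
  rw [(hF.clm_apply (hasDerivAt_const t x)).deriv, map_zero, add_zero]

theorem exists_isCurveFrame (hn : 1 ≤ n) (h : IsParamCurve c s (Ioo 0 b)) (hp : p ∈ Ioo 0 b)
    (e : PseudoBasis n) : ∃ F, IsCurveFrame b c s e F := by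
  obtain ⟨A, hA, hAo, hAι, hAτ⟩ := e.exists_isLorentz hn (h.mink_flatLift_flatLift hp)
    (h.mink_flatDual_flatDual hp) (h.mink_flatLift_flatDual hp)
    (h.mink_flatTangent_flatTangent hp) (h.mink_flatLift_flatTangent hp)
    ((mink_comm _ _).trans (h.mink_flatTangent_flatDual hp))
  obtain ⟨F, hF, hFx⟩ := exists_isLorentz_solution h.contDiffOn_frameForm.continuousOn
    (fun t _ => isSkew_frameForm) hp hA
  have hFo : ∀ t ∈ Ioo 0 b, F t e.o = flatLift c s t := hFx _ _
    (fun t ht => h.frameForm_flatLift ht ▸ h.hasDerivAt ht h.contDiffOn_flatLift) hAo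
  have hFτ : ∀ t ∈ Ioo 0 b, F t e.τ = flatTangent c s t := hFx _ _
    (fun t ht => h.frameForm_flatTangent ht ▸ h.hasDerivAt ht h.contDiffOn_flatTangent) hAτ
  have hFι : ∀ t ∈ Ioo 0 b, F t e.ι = flatDual c s t := hFx _ _
    (fun t ht => h.frameForm_flatDual ht ▸ h.hasDerivAt ht h.contDiffOn_flatDual) hAι
  have hN : ∀ t ∈ Ioo 0 b, ∀ i, ∃ r : ℝ,
      deriv (fun u => F u (e.ν i)) t = r • flatLift c s t := fun t ht i => by
    obtain ⟨hL, hF'⟩ := hF t ht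
    rw [deriv_apply hF', mul_apply_eq_comp]
    exact ⟨_, frameForm_apply_of_orthogonal (by rw [← hFo t ht, hL, e.o_ν])
      (by rw [← hFτ t ht, hL, e.τ_ν]) (by rw [← hFι t ht, hL, e.ι_ν])⟩
  refine ⟨F, contDiffOn_of_linear_ode isOpen_Ioo h.contDiffOn_frameForm fun t ht => (hF t ht).2,
    fun t ht => ⟨(hF t ht).1, hFo t ht, hFτ t ht, fun i => ?_, fun i j => ?_⟩⟩
  · obtain ⟨r, hr⟩ := hN t ht i
    rw [hr, (h.hasDerivAt ht h.contDiffOn_flatLift).deriv, mink_smul_left, mink_smul_right,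
      ← flatTangent, h.mink_flatLift_flatTangent ht, mul_zero, mul_zero]
  · obtain ⟨r, hr⟩ := hN t ht i
    rw [hr, mink_smul_left, ← hFo t ht, (hF t ht).1, e.o_ν, mul_zero]

namespace IsCurveFrame

variable {e : PseudoBasis n} {F : ℝ → EndM n} (hF : IsCurveFrame b c s e F)
  (h : IsParamCurve c s (Ioo 0 b)) (ht : t ∈ Ioo 0 b)

include hF ht

theorem isLorentz : IsLorentz (F t) := (hF.2 t ht).1

theorem apply_o : F t e.o = flatLift c s t := (hF.2 t ht).2.1

theorem apply_τ : F t e.τ = flatTangent c s t := (hF.2 t ht).2.2.1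

theorem hasDerivAt_deriv : HasDerivAt F (deriv F t) t :=
  hasDerivAt_of_contDiffOn hF.1 isOpen_Ioo ht

include h

theorem mink_ν_flatAccel (i : Fin (n - 1)) : mink (F t (e.ν i)) (flatAccel c s t) = 0 := by
  have hNT := (hF.2 t ht).2.2.2.1 i
  rw [(h.hasDerivAt ht h.contDiffOn_flatLift).deriv, mink_smul_right, ← flatTangent] at hNT
  have hk := h.mink_paramDeriv_add_eq_zero ht (x := fun u => F u (e.ν i)) (k := 0)
    (hF.1.clm_apply contDiffOn_const) h.contDiffOn_flatTangent fun u hu => by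
      rw [← hF.apply_τ hu, hF.isLorentz hu, mink_comm, e.τ_ν]
  rwa [paramDeriv, mink_smul_left,
    (mul_eq_zero.1 hNT).resolve_left (h.deriv_pos t ht).ne', mul_zero, zero_add] at hk

theorem apply_ι (hn : 1 ≤ n) : F t e.ι = flatDual c s t := by
  refine ((e.map (hF.isLorentz ht)).eq_ι hn (h.mink_flatDual_flatDual ht) ?_ ?_ fun i => ?_).symm
  · exact (congrArg (mink · _) (hF.apply_o ht)).trans (h.mink_flatLift_flatDual ht)
  · exact (congrArg (mink · _) (hF.apply_τ ht)).trans (h.mink_flatTangent_flatDual ht)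
  · change mink (F t (e.ν i)) _ = 0
    rw [flatDual, mink_add_right, mink_smul_right, hF.mink_ν_flatAccel h ht, ← hF.apply_o ht,
      hF.isLorentz ht, mink_comm (e.ν i), e.o_ν, mul_zero, add_zero]

theorem deriv_apply_eq {a : Mink n} {x : ℝ → Mink n} (hx : ContDiffOn ℝ ∞ x (Ioo 0 b))
    (hFx : ∀ u ∈ Ioo 0 b, F u a = x u) : deriv F t a = deriv s t • paramDeriv s x t := by
  rw [← deriv_apply (hF.hasDerivAt_deriv ht)]
  exact ((h.hasDerivAt ht hx).congr_of_eventuallyEq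
    (Filter.mem_of_superset (isOpen_Ioo.mem_nhds ht) hFx)).deriv

theorem deriv_mul_adjoint_eq (hn : 1 ≤ n) : deriv F t * minkAdjoint (F t) = frameForm c s t := by
  have hL := hF.isLorentz ht
  have hF' := hF.hasDerivAt_deriv ht
  have happly (a : Mink n) : (deriv F t * minkAdjoint (F t)) (F t a) = deriv F t a := by
    rw [mul_apply_eq_comp, hL.adjoint_apply_apply]
  refine (e.map hL).ext_isSkew hn (isSkew_deriv_mul_adjoint (Filter.mem_of_superset
    (isOpen_Ioo.mem_nhds ht) fun u hu => hF.isLorentz hu) hF') isSkew_frameForm ?_ ?_ ?_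
    fun i j => ?_
  · refine (happly e.o).trans ?_
    change _ = frameForm c s t (F t e.o)
    rw [hF.deriv_apply_eq h ht h.contDiffOn_flatLift fun u hu => hF.apply_o hu, hF.apply_o ht,
      h.frameForm_flatLift ht, flatTangent]
  · refine (happly e.ι).trans ?_
    change _ = frameForm c s t (F t e.ι)
    rw [hF.deriv_apply_eq h ht h.contDiffOn_flatDual fun u hu => hF.apply_ι h hu hn,
      hF.apply_ι h ht hn, h.frameForm_flatDual ht]
  · refine (happly e.τ).trans ?_
    change _ = frameForm c s t (F t e.τ)
    rw [hF.deriv_apply_eq h ht h.contDiffOn_flatTangent fun u hu => hF.apply_τ hu, hF.apply_τ ht,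
      h.frameForm_flatTangent ht, flatAccel]
  · change mink ((deriv F t * minkAdjoint (F t)) (F t (e.ν i))) (F t (e.ν j)) =
      mink (frameForm c s t (F t (e.ν i))) (F t (e.ν j))
    rw [happly, ← deriv_apply hF', (hF.2 t ht).2.2.2.2, frameForm_apply_of_orthogonal,
      mink_smul_left, ← hF.apply_o ht, hL, e.o_ν, mul_zero]
    · rw [← hF.apply_o ht, hL, e.o_ν]
    · rw [← hF.apply_τ ht, hL, e.τ_ν]
    · rw [← hF.apply_ι h ht hn, hL, e.ι_ν]

theorem hasDerivAt (hn : 1 ≤ n) : HasDerivAt F (frameForm c s t * F t) t := by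
  rw [← hF.deriv_mul_adjoint_eq h ht hn, mul_assoc, (hF.isLorentz ht).adjoint_mul_self, mul_one]
  exact hF.hasDerivAt_deriv ht

end IsCurveFrame

theorem boost_apply (e : PseudoBasis n) (r : ℝ) (x : Mink n) : boost e r x =
    x + ((1 - r⁻¹) * mink e.ι x) • e.o + ((1 - r) * mink e.o x) • e.ι := rfl

theorem isLorentz_boost (e : PseudoBasis n) {r : ℝ} (hr : r ≠ 0) : IsLorentz (boost e r) :=
  fun x y => by
    simp only [boost_apply, mink_add_left, mink_add_right, mink_smul_left, mink_smul_right, e.o_o,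
      e.ι_ι, e.o_ι, mink_comm e.ι e.o, mink_comm x e.o, mink_comm x e.ι]
    field_simp
    ring

theorem hasDerivAt_boost (e : PseudoBasis n) {s' : ℝ} (hs : HasDerivAt s s' t) (h0 : s t ≠ 0) :
    HasDerivAt (fun u => boost e (s u)) (boost e (s t) * ((s' / s t) • wedge e.ι e.o)) t := by
  have hboost : ∀ r, boost e r = 1 + (1 - r⁻¹) • (minkForm n e.ι).smulRight e.o +
      (1 - r) • (minkForm n e.o).smulRight e.ι := fun r => by
    ext1 x
    simp only [boost_apply, _root_.add_apply, _root_.smul_apply, one_apply_eq_self,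
      ContinuousLinearMap.smulRight_apply, minkForm_apply, smul_smul]
  have hι := (((hs.inv h0).const_sub 1).smul_const ((minkForm n e.ι).smulRight e.o)).const_add
    (1 : EndM n)
  have ho := (hs.const_sub 1).smul_const ((minkForm n e.o).smulRight e.ι)
  simp only [hboost]
  refine (hι.add ho).congr_deriv ?_
  rw [← hboost]
  ext1 x
  simp only [mul_apply_eq_comp, _root_.add_apply, _root_.smul_apply, wedge_apply, map_smul, map_sub,
    boost_o, boost_ι, ContinuousLinearMap.smulRight_apply, minkForm_apply]
  match_scalars <;> field_simp

section SingFrame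

variable {e : PseudoBasis n} {F : ℝ → EndM n}

theorem isLorentz_singFrame (hF : IsLorentz (F t)) (h0 : s t ≠ 0) :
    IsLorentz (singFrame s e F t) :=
  hF.mul (isLorentz_boost e h0)

theorem singFrame_smul_o (h0 : s t ≠ 0) : singFrame s e F t (s t • e.o) = F t e.o := by
  rw [singFrame, mul_apply_eq_comp, map_smul, boost_o, smul_inv_smul₀ h0]

theorem singFrame_inv_smul_ι (h0 : s t ≠ 0) : singFrame s e F t ((s t)⁻¹ • e.ι) = F t e.ι := by
  rw [singFrame, mul_apply_eq_comp, map_smul, boost_ι, inv_smul_smul₀ h0]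

theorem singFrame_of_orthogonal {x : Mink n} (ho : mink e.o x = 0) (hι : mink e.ι x = 0) :
    singFrame s e F t x = F t x := by
  rw [singFrame, mul_apply_eq_comp, boost_of_orthogonal e _ ho hι]

theorem hasDerivAt_singFrame {F' : EndM n} {s' : ℝ} (hF : HasDerivAt F F' t)
    (hs : HasDerivAt s s' t) (h0 : s t ≠ 0) : HasDerivAt (singFrame s e F)
      (F' * boost e (s t) + singFrame s e F t * ((s' / s t) • wedge e.ι e.o)) t := by
  rw [singFrame, mul_assoc]
  exact hF.mul (hasDerivAt_boost e hs h0)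

theorem IsLorentz.smul_wedge_mul {A : EndM n} (hA : IsLorentz A) (r : ℝ) (v w : Mink n) :
    (r • wedge (A v) (A w)) * A = A * (r • wedge v w) := by
  ext1 x
  have hx := DFunLike.congr_fun (hA.mul_wedge v w) x
  rw [mul_apply_eq_comp, mul_apply_eq_comp] at hx
  rw [mul_apply_eq_comp, mul_apply_eq_comp, _root_.smul_apply, _root_.smul_apply, map_smul, hx]

/-- The derivative `df̄/ds` of the dual null vector, written in the frame `F`. -/
def regularPart (c : ℝ → Mink n) (s : ℝ → ℝ) (F : ℝ → EndM n) (t : ℝ) : Mink n :=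
  minkAdjoint (F t) (paramDeriv s (flatDual c s) t)

/-- The difference `-s ds o ∧ F⁻¹(df̄/ds)` of the gauge transform of `λω` by the singular frame and
the pure pole form. It does not depend on `λ`, and the factor `s` makes it vanish at `0`. -/
def gaugeRemainder (c : ℝ → Mink n) (s : ℝ → ℝ) (e : PseudoBasis n) (F : ℝ → EndM n) (t : ℝ) :
    EndM n :=
  -((deriv s t * s t) • wedge e.o (regularPart c s F t))

theorem isSkew_gaugeRemainder : IsSkew (gaugeRemainder c s e F t) :=
  ((isSkew_wedge _ _).smul _).neg

namespace IsCurveFrame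

variable (hF : IsCurveFrame b c s e F) (h : IsParamCurve c s (Ioo 0 b)) (ht : t ∈ Ioo 0 b)
include hF ht

theorem apply_regularPart : F t (regularPart c s F t) = paramDeriv s (flatDual c s) t := by
  rw [regularPart, ← mul_apply_eq_comp, (hF.isLorentz ht).mul_adjoint_self, one_apply_eq_self]

include h

theorem mink_o_regularPart : mink e.o (regularPart c s F t) = 0 := by
  rw [← hF.isLorentz ht, hF.apply_regularPart ht, hF.apply_o ht, h.mink_flatLift_deriv_flatDual ht]

theorem mink_ι_regularPart (hn : 1 ≤ n) : mink e.ι (regularPart c s F t) = 0 := by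
  rw [← hF.isLorentz ht, hF.apply_regularPart ht, hF.apply_ι h ht hn,
    h.mink_flatDual_deriv_flatDual ht]

theorem gauge_singFrame {Q : ℝ → ℝ} {q : ℝ} (hn : 1 ≤ n) (lam : ℝ) (h0 : s t ≠ 0)
    (hQ : Q t = q * (deriv s t) ^ 2 / (s t) ^ 2) :
    gauge (singFrame s e F) (lam • assocForm c Q) t =
      poleForm s e (q * lam) t + gaugeRemainder c s e F t := by
  have hg := isLorentz_singFrame (e := e) (hF.isLorentz ht) h0
  have hgf := (singFrame_smul_o (e := e) (F := F) h0).trans (hF.apply_o ht)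
  have hgT := (singFrame_of_orthogonal (s := s) (F := F) e.o_τ e.ι_τ).trans (hF.apply_τ ht)
  have hgd := (singFrame_inv_smul_ι (e := e) (F := F) h0).trans (hF.apply_ι h ht hn)
  have hgv := (singFrame_of_orthogonal (s := s) (F := F) (hF.mink_o_regularPart h ht)
    (hF.mink_ι_regularPart h ht hn)).trans (hF.apply_regularPart ht)
  have hω : (lam • assocForm c Q) t * singFrame s e F t = singFrame s e F t *
      ((lam * (Q t / deriv s t)) • wedge (s t • e.o) e.τ) := by
    rw [← hg.smul_wedge_mul, hgf, hgT, Pi.smul_apply, h.assocForm_eq ht, smul_smul]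
  have hB : frameForm c s t * singFrame s e F t = singFrame s e F t *
      (deriv s t • wedge e.τ ((s t)⁻¹ • e.ι) -
        deriv s t • wedge (s t • e.o) (regularPart c s F t)) := by
    rw [mul_sub, ← hg.smul_wedge_mul, ← hg.smul_wedge_mul, hgf, hgT, hgd, hgv, ← sub_mul,
      ← smul_sub, frameForm]
  refine gauge_eq hg (hasDerivAt_singFrame (hF.hasDerivAt h ht hn)
    (hasDerivAt_of_contDiffOn h.smooth h.isOpen ht) h0) ?_
  rw [mul_assoc, ← singFrame, hω, hB, ← mul_add, ← mul_add, hQ, poleForm_eq]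
  congr 1
  ext1 x
  have hs := (h.deriv_pos t ht).ne'
  simp only [gaugeRemainder, _root_.add_apply, _root_.sub_apply, _root_.neg_apply,
    _root_.smul_apply, wedge_smul_left, wedge_smul_right, wedge_apply, poleGen_apply]
  match_scalars <;> field_simp <;> ring

end IsCurveFrame

end SingFrame

end Frames

/-! ### Normal parameters -/

section Hadamard

variable {E : Type*} [NormedAddCommGroup E] [NormedSpace ℝ E] {I : Set ℝ} {f : ℝ → E} {t : ℝ}

/-- The weighted mean `∫₀¹ u^k f(ut) du` of `f` along the segment from `0` to `t`. -/
def radialMean (f : ℝ → E) (k : ℕ) (t : ℝ) : E := ∫ u in (0 : ℝ)..1, u ^ k • f (u * t)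

theorem continuousOn_radial (hI : StarConvex ℝ 0 I) (hf : ContinuousOn f I) (k : ℕ) (ht : t ∈ I) :
    ContinuousOn (fun u => u ^ k • f (u * t)) (uIcc 0 1) := by
  rw [uIcc_of_le zero_le_one]
  exact (continuous_pow k).continuousOn.smul
    (hf.comp (by fun_prop) fun u hu => hI.smul_mem ht hu.1 hu.2)

theorem hasDerivAt_radialMean (hI : StarConvex ℝ 0 I) (hIo : IsOpen I) (hf : ContDiffOn ℝ ∞ f I)
    (k : ℕ) (ht : t ∈ I) :
    HasDerivAt (radialMean f k) (radialMean (deriv f) (k + 1) t) t := by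
  obtain ⟨K, hK, htK, hKI⟩ := exists_compact_subset hIo ht
  have hf' := (contDiffOn_deriv hf hIo).continuousOn
  obtain ⟨M, hM⟩ := (isCompact_Icc.prod hK).exists_bound_of_continuousOn
    (f := fun y : ℝ × ℝ => deriv f (y.1 * y.2))
    (hf'.comp (by fun_prop) fun y hy => hI.smul_mem (hKI hy.2) hy.1.1 hy.1.2)
  have hmem {u : ℝ} (hu : u ∈ uIoc (0 : ℝ) 1) : u ∈ Icc (0 : ℝ) 1 :=
    Ioc_subset_Icc_self (uIoc_of_le (zero_le_one' ℝ) ▸ hu)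
  refine (intervalIntegral.hasDerivAt_integral_of_dominated_loc_of_deriv_le
    (F := fun x u => u ^ k • f (u * x)) (F' := fun x u => u ^ (k + 1) • deriv f (u * x))
    (bound := fun _ => M) (isOpen_interior.mem_nhds htK) ?_
    (continuousOn_radial hI hf.continuousOn k ht).intervalIntegrable
    (continuousOn_radial hI hf' (k + 1) ht).intervalIntegrable.aestronglyMeasurable_restrict_uIoc
    ?_ intervalIntegrable_const ?_).2
  · filter_upwards [hIo.mem_nhds ht] with x hx using (continuousOn_radial hI hf.continuousOn k
      hx).intervalIntegrable.aestronglyMeasurable_restrict_uIoc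
  · refine Eventually.of_forall fun u hu x hx => ?_
    obtain ⟨hu₀, hu₁⟩ := hmem hu
    rw [norm_smul, norm_pow, Real.norm_of_nonneg hu₀]
    exact (mul_le_of_le_one_left (norm_nonneg _) (pow_le_one₀ hu₀ hu₁)).trans
      (hM (u, x) ⟨⟨hu₀, hu₁⟩, interior_subset hx⟩)
  · refine Eventually.of_forall fun u hu x hx => ?_
    have hux := hI.smul_mem (hKI (interior_subset hx)) (hmem hu).1 (hmem hu).2
    have hfu := ((hasDerivAt_of_contDiffOn hf hIo hux).scomp x
      ((hasDerivAt_id x).const_mul u)).const_smul (u ^ k)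
    rwa [mul_one, smul_smul, ← pow_succ] at hfu

theorem contDiffOn_radialMean (hI : StarConvex ℝ 0 I) (hIo : IsOpen I) (hf : ContDiffOn ℝ ∞ f I)
    (k : ℕ) : ContDiffOn ℝ ∞ (radialMean f k) I := by
  refine contDiffOn_infty.2 fun m => ?_
  induction m generalizing f k with
  | zero => exact contDiffOn_zero.2 fun t ht =>
      (hasDerivAt_radialMean hI hIo hf k ht).continuousAt.continuousWithinAt
  | succ m ih =>
    push_cast
    refine (contDiffOn_succ_iff_deriv_of_isOpen hIo).2 ⟨fun t ht =>
      (hasDerivAt_radialMean hI hIo hf k ht).differentiableAt.differentiableWithinAt,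
      fun h => absurd h WithTop.coe_ne_top, ?_⟩
    exact (ih (contDiffOn_deriv hf hIo) (k + 1)).congr fun t ht =>
      (hasDerivAt_radialMean hI hIo hf k ht).deriv

variable [CompleteSpace E]

theorem exists_eq_smul_of_contDiffOn (hI : StarConvex ℝ 0 I) (hIo : IsOpen I)
    (hf : ContDiffOn ℝ ∞ f I) (h0 : f 0 = 0) :
    ∃ ρ, ContDiffOn ℝ ∞ ρ I ∧ ∀ t ∈ I, f t = t • ρ t := by
  have hf' := contDiffOn_deriv hf hIo
  refine ⟨radialMean (deriv f) 0, contDiffOn_radialMean hI hIo hf' 0, fun t ht => ?_⟩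
  have hradial : ∀ u ∈ uIcc (0 : ℝ) 1,
      HasDerivAt (fun u => f (u * t)) (t • u ^ 0 • deriv f (u * t)) u := fun u hu => by
    rw [uIcc_of_le zero_le_one] at hu
    rw [pow_zero, one_smul]
    have h := (hasDerivAt_of_contDiffOn hf hIo (hI.smul_mem ht hu.1 hu.2)).scomp u
      ((hasDerivAt_id u).mul_const t)
    rwa [one_mul] at h
  have hftc := intervalIntegral.integral_eq_sub_of_hasDerivAt hradial
    ((continuousOn_radial hI hf'.continuousOn 0 ht).const_smul t).intervalIntegrable
  rwa [intervalIntegral.integral_smul, one_mul, zero_mul, h0, sub_zero, eq_comm] at hftc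

theorem exists_contDiffOn_primitive (hI : I.OrdConnected) (hIo : IsOpen I) {a : ℝ} (ha : a ∈ I)
    (hf : ContDiffOn ℝ ∞ f I) : ∃ g, ContDiffOn ℝ ∞ g I ∧ ∀ t ∈ I, HasDerivAt g (f t) t := by
  have hg : ∀ t ∈ I, HasDerivAt (fun t => ∫ x in a..t, f x) (f t) t := fun t ht =>
    intervalIntegral.integral_hasDerivAt_right
      ((hf.continuousOn.mono (hI.uIcc_subset ha ht)).intervalIntegrable)
      (hf.continuousOn.stronglyMeasurableAtFilter hIo t ht)
      (hf.continuousOn.continuousAt (hIo.mem_nhds ht))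
  exact ⟨_, (contDiffOn_infty_iff_deriv_of_isOpen hIo).2
    ⟨fun t ht => (hg t ht).differentiableAt.differentiableWithinAt,
      hf.congr fun t ht => (hg t ht).deriv⟩, hg⟩

end Hadamard

section NormalParam

theorem pos_of_isPreconnected {X : Type*} [TopologicalSpace X] {S : Set X} (hS : IsPreconnected S)
    {f : X → ℝ} (hf : ContinuousOn f S) (hf₀ : ∀ x ∈ S, f x ≠ 0) {a x : X} (ha : a ∈ S)
    (hfa : 0 < f a) (hx : x ∈ S) : 0 < f x := by
  by_contra! hle
  obtain ⟨y, hy, hy₀⟩ := hS.intermediate_value hx ha hf ⟨hle, hfa.le⟩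
  exact hf₀ y hy hy₀

variable {b : ℝ} {Q : ℝ → ℝ} {q : ℝ}

theorem HasPole.exists_pos_factor (hpole : HasPole 2 b Q q) (hb : 0 < b)
    (hQ : ∀ t ∈ Ioo 0 b, Q t ≠ 0) : ∃ η > 0, ∃ κ : ℝ → ℝ, ContDiffOn ℝ ∞ κ (Ioo (-η) b) ∧
      (∀ t ∈ Ioo (-η) b, 0 < κ t) ∧ κ 0 = 1 ∧ ∀ t ∈ Ioo 0 b, Q t * t ^ 2 = q * κ t := by
  obtain ⟨hq, δ, hδ, h, hh, hh0, hhQ⟩ := hpole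
  have h0 : ∀ᶠ t in 𝓝 (0 : ℝ), h t ≠ 0 :=
    (hh.continuousOn.continuousAt (Ioo_mem_nhds (neg_lt_zero.2 hδ) hb)).eventually_ne (hh0 ▸ hq)
  obtain ⟨η, hη, hη0⟩ := Metric.eventually_nhds_iff_ball.1 h0
  simp only [Real.ball_eq_Ioo, zero_sub, zero_add] at hη0
  have hsub : Ioo (-min η δ) b ⊆ Ioo (-δ) b := Ioo_subset_Ioo_left (neg_le_neg (min_le_right η δ))
  have hne : ∀ t ∈ Ioo (-min η δ) b, h t ≠ 0 := fun t ht => by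
    rcases lt_or_ge t η with htη | htη
    · exact hη0 t ⟨(neg_le_neg (min_le_left η δ)).trans_lt ht.1, htη⟩
    · have ht₀ := hη.trans_le htη
      rw [hhQ t ⟨ht₀, ht.2⟩, zero_sub, neg_sq]
      exact mul_ne_zero (hQ t ⟨ht₀, ht.2⟩) (pow_ne_zero 2 ht₀.ne')
  have hκ := (hh.mono hsub).div_const q
  have hκ0 : h 0 / q = 1 := by rw [hh0, div_self hq]
  refine ⟨min η δ, lt_min hη hδ, _, hκ, fun t ht => ?_, hκ0, fun t ht => ?_⟩
  · exact pos_of_isPreconnected isPreconnected_Ioo hκ.continuousOn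
      (fun u hu => div_ne_zero (hne u hu) hq) ⟨neg_lt_zero.2 (lt_min hη hδ), hb⟩
      (hκ0 ▸ zero_lt_one) ht
  · rw [mul_div_cancel₀ _ hq, hhQ t ht, zero_sub, neg_sq]

/-- With `Q t² = q κ` and `√κ - 1 = t ρ`, the parameter `s = t exp ∫ρ` has `ds = √κ exp (∫ρ) dt`. -/
theorem exists_isNormalParam (hb : 0 < b) (hQ : ∀ t ∈ Ioo 0 b, Q t ≠ 0) (hpole : HasPole 2 b Q q) :
    ∃ s, IsNormalParam b Q q s := by
  obtain ⟨η, hη, κ, hκ, hpos, hκ0, hκQ⟩ := hpole.exists_pos_factor hb hQ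
  have h0 : (0 : ℝ) ∈ Ioo (-η) b := ⟨neg_lt_zero.2 hη, hb⟩
  obtain ⟨ρ, hρ, hρeq⟩ := exists_eq_smul_of_contDiffOn ((convex_Ioo (-η) b).starConvex h0)
    isOpen_Ioo ((hκ.sqrt fun t ht => (hpos t ht).ne').sub (contDiffOn_const (c := 1)))
    (by rw [hκ0, Real.sqrt_one, sub_self])
  obtain ⟨E, hE, hE'⟩ := exists_contDiffOn_primitive ordConnected_Ioo isOpen_Ioo h0 hρ
  have hs' : ∀ t ∈ Ioo (-η) b,
      deriv (fun t => t * Real.exp (E t)) t = √(κ t) * Real.exp (E t) := fun t ht => by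
    refine ((hasDerivAt_id' t).mul (hE' t ht).exp).deriv.trans ?_
    rw [sub_eq_iff_eq_add.1 (hρeq t ht), smul_eq_mul]
    ring
  refine ⟨fun t => t * Real.exp (E t), ⟨η, hη, contDiffOn_id.mul hE.exp, fun t ht => ?_⟩,
    zero_mul _, fun t ht => ?_⟩
  · rw [hs' t ht]
    exact mul_pos (Real.sqrt_pos.2 (hpos t ht)) (Real.exp_pos _)
  · have htη : t ∈ Ioo (-η) b := ⟨h0.1.trans ht.1, ht.2⟩
    have ht₀ := ht.1.ne'
    rw [hs' t htη, mul_pow, mul_pow, Real.sq_sqrt (hpos t htη).le, eq_div_iff (by positivity),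
      ← mul_assoc, hκQ t ht, mul_assoc]

end NormalParam

/-! ### Metrics of the conformal structure -/

section ConformalDist

section Normalize

variable {E : Type*} [NormedAddCommGroup E] [InnerProductSpace ℝ E]

theorem hasDerivAt_normalize {v : ℝ → E} {v' : E} {t : ℝ} (hv : HasDerivAt v v' t) (h₀ : v t ≠ 0) :
    HasDerivAt (fun u => NormedSpace.normalize (v u))
      (‖v t‖⁻¹ • (ℝ ∙ v t)ᗮ.starProjection v') t := by
  have hne : ‖v t‖ ≠ 0 := norm_ne_zero_iff.2 h₀
  have hnorm : HasDerivAt (fun u => ‖v u‖) (inner ℝ (v t) v' / ‖v t‖) t := by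
    have h := hv.norm_sq.sqrt (pow_ne_zero 2 hne)
    simp only [Real.sqrt_sq (norm_nonneg _)] at h
    rwa [mul_div_mul_left _ _ two_ne_zero] at h
  refine ((hnorm.inv hne).smul hv).congr_deriv ?_
  rw [Submodule.starProjection_orthogonal_val, Submodule.starProjection_singleton, Pi.inv_apply]
  simp only [RCLike.ofReal_real_eq_id, id]
  match_scalars <;> field_simp

theorem norm_deriv_normalize_le {v : ℝ → E} {v' : E} {t : ℝ} (hv : HasDerivAt v v' t)
    (h₀ : v t ≠ 0) : ‖deriv (fun u => NormedSpace.normalize (v u)) t‖ ≤ ‖v t‖⁻¹ * ‖v'‖ := by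
  rw [(hasDerivAt_normalize hv h₀).deriv, norm_smul, norm_inv, norm_norm]
  gcongr
  exact Submodule.norm_starProjection_apply_le _ v'

theorem contDiffOn_normalize {v : ℝ → E} {m : WithTop ℕ∞} {I : Set ℝ} (hv : ContDiffOn ℝ m v I)
    (h₀ : ∀ t ∈ I, v t ≠ 0) : ContDiffOn ℝ m (fun u => NormedSpace.normalize (v u)) I :=
  ((hv.norm ℝ h₀).inv fun t ht => norm_ne_zero_iff.2 (h₀ t ht)).smul hv

theorem half_le_norm_lineMap {P P' : E} (hP : ‖P‖ = 1) (hPP : dist P P' ≤ 1 / 2) {u : ℝ}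
    (hu : u ∈ Icc (0 : ℝ) 1) : 1 / 2 ≤ ‖AffineMap.lineMap P P' u‖ := by
  have hdist : dist (AffineMap.lineMap P P' u) P ≤ 1 / 2 := by
    rw [dist_lineMap_left, Real.norm_eq_abs, abs_of_nonneg hu.1]
    exact (mul_le_of_le_one_left dist_nonneg hu.2).trans hPP
  have hle := norm_sub_norm_le P (AffineMap.lineMap P P' u)
  rw [hP, ← dist_eq_norm, dist_comm] at hle
  linarith

end Normalize

variable {n : ℕ}

theorem conformalDist_le_lintegral (φ : Amb n → ℝ) {γ : ℝ → Amb n} (hγ : ContDiffOn ℝ 1 γ (Icc 0 1))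
    (hnorm : ∀ u ∈ Icc (0 : ℝ) 1, ‖γ u‖ = 1) :
    conformalDist φ (γ 0) (γ 1) ≤
      ∫⁻ u in Icc (0 : ℝ) 1, ENNReal.ofReal (φ (γ u) * ‖derivWithin γ (Icc 0 1) u‖) :=
  iInf₂_le γ ⟨hγ, hnorm, rfl, rfl⟩

theorem conformalDist_le {φ : Amb n → ℝ} {K : ℝ} (hφK : ∀ P ∈ Metric.sphere (0 : Amb n) 1, φ P ≤ K)
    (hK : 0 ≤ K) {P P' : Amb n} (hP : ‖P‖ = 1) (hP' : ‖P'‖ = 1) (hPP : dist P P' ≤ 1 / 2) :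
    conformalDist φ P P' ≤ ENNReal.ofReal (K * (2 * dist P P')) := by
  let v : ℝ → Amb n := AffineMap.lineMap P P'
  let γ : ℝ → Amb n := fun u => NormedSpace.normalize (v u)
  have hv (u : ℝ) : HasDerivAt v (P' - P) u := AffineMap.hasDerivAt_lineMap
  have hle (u) (hu : u ∈ Icc (0 : ℝ) 1) : 1 / 2 ≤ ‖v u‖ := half_le_norm_lineMap hP hPP hu
  have hne (u) (hu : u ∈ Icc (0 : ℝ) 1) : v u ≠ 0 :=
    norm_pos_iff.1 (one_half_pos.trans_le (hle u hu))
  have hγ : ContDiffOn ℝ 1 γ (Icc 0 1) :=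
    contDiffOn_normalize (AffineMap.contDiff_lineMap P P').contDiffOn hne
  have hnorm (u) (hu : u ∈ Icc (0 : ℝ) 1) : ‖γ u‖ = 1 :=
    NormedSpace.norm_normalize_eq_one_iff.2 (hne u hu)
  have hspeed (u) (hu : u ∈ Icc (0 : ℝ) 1) :
      ‖derivWithin γ (Icc 0 1) u‖ ≤ 2 * dist P P' := by
    have hd := hasDerivAt_normalize (hv u) (hne u hu)
    rw [hd.differentiableAt.derivWithin (uniqueDiffOn_Icc zero_lt_one u hu), dist_comm,
      dist_eq_norm]
    refine (norm_deriv_normalize_le (hv u) (hne u hu)).trans ?_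
    gcongr
    exact inv_le_of_inv_le₀ two_pos (by simpa using hle u hu)
  have hγ₀ : γ 0 = P := by
    simp only [γ, v, AffineMap.lineMap_apply_zero, NormedSpace.normalize_eq_self_of_norm_eq_one hP]
  have hγ₁ : γ 1 = P' := by
    simp only [γ, v, AffineMap.lineMap_apply_one, NormedSpace.normalize_eq_self_of_norm_eq_one hP']
  calc conformalDist φ P P'
      ≤ ∫⁻ u in Icc (0 : ℝ) 1, ENNReal.ofReal (φ (γ u) * ‖derivWithin γ (Icc 0 1) u‖) := by
        rw [← hγ₀, ← hγ₁]
        exact conformalDist_le_lintegral φ hγ hnorm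
    _ ≤ ∫⁻ _ in Icc (0 : ℝ) 1, ENNReal.ofReal (K * (2 * dist P P')) := by
        refine MeasureTheory.setLIntegral_mono' measurableSet_Icc fun u hu => ?_
        exact ENNReal.ofReal_le_ofReal <| mul_le_mul (hφK _ (by simpa using hnorm u hu))
          (hspeed u hu) (norm_nonneg _) hK
    _ = ENNReal.ofReal (K * (2 * dist P P')) := by simp

theorem tendsto_conformalDist {α : Type*} {l : Filter α} {φ : Amb n → ℝ} (hφ : IsConformalFactor φ)
    {P P' : α → Amb n} (hP : ∀ᶠ t in l, ‖P t‖ = 1) (hP' : ∀ᶠ t in l, ‖P' t‖ = 1)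
    (h : Tendsto (fun t => dist (P t) (P' t)) l (𝓝 0)) :
    Tendsto (fun t => conformalDist φ (P t) (P' t)) l (𝓝 0) := by
  obtain ⟨K, hK⟩ := (isCompact_sphere (0 : Amb n) 1).exists_bound_of_continuousOn hφ.1
  have hφK : ∀ P ∈ Metric.sphere (0 : Amb n) 1, φ P ≤ |K| := fun P hP =>
    (le_abs_self _).trans ((hK P hP).trans (le_abs_self K))
  have hlim : Tendsto (fun t => ENNReal.ofReal (|K| * (2 * dist (P t) (P' t)))) l (𝓝 0) := by
    simpa using ENNReal.tendsto_ofReal ((h.const_mul 2).const_mul |K|)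
  refine tendsto_of_tendsto_of_tendsto_of_le_of_le' tendsto_const_nhds hlim
    (Eventually.of_forall fun _ => zero_le) ?_
  filter_upwards [hP, hP', h.eventually_le_const one_half_pos] with t hPt hPt' hdist
  exact conformalDist_le hφK (abs_nonneg K) hPt hPt' hdist

end ConformalDist

section LightCone

variable {n : ℕ}

/-- `x` is a nonzero vector of the light cone, that is, it represents a point of the conformal
sphere. -/
def IsLightlike (x : Mink n) : Prop := x ≠ 0 ∧ mink x x = 0

namespace IsLightlike

variable {x : Mink n}

theorem zero_ne (hx : IsLightlike x) : x 0 ≠ 0 := mink_zero_ne hx.1 hx.2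

theorem norm_pt (hx : IsLightlike x) : ‖pt x‖ = 1 := Calapso.norm_pt hx.1 hx.2

theorem map (hx : IsLightlike x) {A : EndM n} (hA : IsLorentz A) : IsLightlike (A x) :=
  ⟨hA.apply_ne_zero hx.1, (hA x x).trans hx.2⟩

end IsLightlike

theorem pt_smul {r : ℝ} (hr : r ≠ 0) (x : Mink n) : pt (r • x) = pt x := by
  ext i
  exact mul_div_mul_left _ _ hr

theorem pt_eq_spatial (x : Mink n) : pt x = (x 0)⁻¹ • spatial n x := by
  ext i
  exact div_eq_inv_mul _ _

theorem continuousAt_pt {x : Mink n} (h₀ : x 0 ≠ 0) : ContinuousAt pt x := by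
  simp only [funext pt_eq_spatial]
  exact ((EuclideanSpace.proj (𝕜 := ℝ) (0 : Fin (n + 2))).continuous.continuousAt.inv₀ h₀).smul
    (spatial n).continuous.continuousAt

theorem hasDerivAt_pt {x : ℝ → Mink n} {x' : Mink n} {t : ℝ} (hx : HasDerivAt x x' t)
    (h₀ : x t 0 ≠ 0) :
    HasDerivAt (fun u => pt (x u)) ((x t 0)⁻¹ • spatial n (x' - (x' 0 / x t 0) • x t)) t := by
  have hcoord : HasDerivAt (fun u => x u 0) (x' 0) t :=
    (EuclideanSpace.proj (𝕜 := ℝ) (0 : Fin (n + 2))).hasFDerivAt.comp_hasDerivAt t hx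
  have hspatial : HasDerivAt (fun u => spatial n (x u)) (spatial n x') t :=
    (spatial n).hasFDerivAt.comp_hasDerivAt t hx
  simp only [pt_eq_spatial]
  refine ((hcoord.inv h₀).smul hspatial).congr_deriv ?_
  simp only [Pi.inv_apply, map_sub, map_smul]
  match_scalars <;> field_simp

theorem mink_deriv_eq_zero {x : ℝ → Mink n} {x' : Mink n} {t : ℝ} (hx : HasDerivAt x x' t)
    (hnull : ∀ᶠ u in 𝓝 t, mink (x u) (x u) = 0) : mink (x t) x' = 0 := by
  have h : mink x' (x t) + mink (x t) x' = 0 :=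
    (hasDerivAt_mink hx hx).unique ((hasDerivAt_const t (0 : ℝ)).congr_of_eventuallyEq hnull)
  rw [mink_comm x'] at h
  linarith

theorem norm_deriv_pt {x : ℝ → Mink n} {x' : Mink n} {t : ℝ} (hx : HasDerivAt x x' t)
    (hlight : ∀ᶠ u in 𝓝 t, IsLightlike (x u)) :
    ‖deriv (fun u => pt (x u)) t‖ = √(mink x' x') / |x t 0| := by
  have h₀ := hlight.self_of_nhds.zero_ne
  have hxx := hlight.self_of_nhds.2
  have hxx' := mink_deriv_eq_zero hx (hlight.mono fun u hu => hu.2)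
  set y := x' - (x' 0 / x t 0) • x t with hy
  have hy₀ : y 0 = 0 := by
    rw [hy, PiLp.sub_apply, PiLp.smul_apply, smul_eq_mul, div_mul_cancel₀ _ h₀, sub_self]
  have hyy : mink y y = mink x' x' := by
    simp only [hy, mink_sub_left, mink_sub_right, mink_smul_left, mink_smul_right,
      mink_comm x' (x t), hxx, hxx', mul_zero, sub_zero]
  have hnorm : ‖spatial n y‖ = √(mink x' x') := by
    rw [← hyy, mink_eq_spatial, hy₀, mul_zero, neg_zero, zero_add, ← norm_eq_sqrt_real_inner]
  rw [(hasDerivAt_pt hx h₀).deriv, norm_smul, norm_inv, Real.norm_eq_abs, hnorm, div_eq_inv_mul]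

end LightCone

/-! ### Motions on the limit circle -/

section Periodic

variable {X : Type*} {f : ℝ → X} {T : ℝ}

theorem image_comp_eq_range_of_periodic (hf : Function.Periodic f T) (hT : 0 < T) {w : ℝ → ℝ}
    {δ : ℝ} (hδ : 0 < δ) (hw : ContinuousOn w (Ioo 0 δ)) (hlim : Tendsto w (𝓝[>] 0) atBot) :
    (fun t => f (w t)) '' Ioo 0 δ = range f := by
  refine Subset.antisymm (fun P ⟨t, _, hP⟩ => ⟨w t, hP⟩) ?_
  rintro _ ⟨v, rfl⟩
  have hmid : δ / 2 ∈ Ioo 0 δ := ⟨by linarith, by linarith⟩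
  have hnear : 𝓝[>] (0 : ℝ) ≤ 𝓟 (Ioo 0 δ) := le_principal_iff.2 (Ioo_mem_nhdsGT hδ)
  obtain ⟨N, hN⟩ := exists_nat_ge ((v - w (δ / 2)) / T)
  rw [div_le_iff₀ hT] at hN
  obtain ⟨t, ht, htv⟩ := isPreconnected_Ioo.intermediate_value_Iic hmid hnear hw hlim
    (show v - N * T ∈ Iic (w (δ / 2)) by rw [mem_Iic]; linarith)
  exact ⟨t, ht, by simp only [htv, hf.sub_nat_mul_eq]⟩

theorem exists_pos_forall_le_of_periodic {f : ℝ → ℝ} (hf : Function.Periodic f T) (hT : T ≠ 0)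
    (hcont : Continuous f) (hpos : ∀ u, 0 < f u) : ∃ m > 0, ∀ u, m ≤ f u := by
  obtain ⟨_, ⟨u₀, rfl⟩, hmin⟩ :=
    (hf.compact_of_continuous hT hcont).exists_isLeast (range_nonempty f)
  exact ⟨f u₀, hpos u₀, fun u => hmin ⟨u, rfl⟩⟩

end Periodic

section ClusterPoints

variable {X : Type*} [PseudoMetricSpace X]

theorem tendsto_dist_of_isCompact {α Y Z : Type*} [TopologicalSpace Y] [TopologicalSpace Z]
    {l : Filter α} {f : Y → Z → X} {y₀ : Y} {K : Set Z} (hK : IsCompact K)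
    (hf : ∀ z ∈ K, ContinuousAt f.uncurry (y₀, z)) {y : α → Y} (hy : Tendsto y l (𝓝 y₀))
    {z : α → Z} (hz : ∀ t, z t ∈ K) :
    Tendsto (fun t => dist (f (y t) (z t)) (f y₀ (z t))) l (𝓝 0) := by
  refine Metric.tendsto_nhds.2 fun ε hε => ?_
  have hlocal (z) (hz : z ∈ K) :
      ∀ᶠ w : Y × Z in 𝓝 (y₀, z), dist (f w.1 w.2) (f y₀ w.2) < ε := by
    have hw : ContinuousAt (fun w : Y × Z => f y₀ w.2) (y₀, z) :=
      ContinuousAt.comp (g := f.uncurry) (f := fun w : Y × Z => (y₀, w.2)) (x := (y₀, z)) (hf z hz)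
        (by fun_prop)
    exact ((hf z hz).dist hw).eventually_lt continuousAt_const
      (by simpa only [Function.uncurry_apply_pair, dist_self] using hε)
  have hunif : ∀ᶠ y in 𝓝 y₀, ∀ z ∈ K, dist (f y z) (f y₀ z) < ε :=
    hK.eventually_forall_of_forall_eventually (P := fun y z => dist (f y z) (f y₀ z) < ε) hlocal
  filter_upwards [hy.eventually hunif] with t ht
  simpa only [dist_zero_right, Real.norm_eq_abs, abs_dist] using ht (z t) (hz t)

theorem mapClusterPt_iff_of_tendsto_dist {α : Type*} {l : Filter α} {x y : α → X}
    (hxy : Tendsto (fun t => dist (x t) (y t)) l (𝓝 0)) {P : X} :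
    MapClusterPt P l x ↔ MapClusterPt P l y := by
  simp only [mapClusterPt_iff_ultrafilter]
  exact exists_congr fun U => and_congr_right fun hU => tendsto_iff_of_dist (hxy.mono_left hU)

theorem setOf_mapClusterPt_nhdsGT_eq {S : Set X} (hS : IsClosed S) {y : ℝ → X} {b : ℝ} (hb : 0 < b)
    (hy : ∀ δ ∈ Ioc 0 b, y '' Ioo 0 δ = S) : {P | MapClusterPt P (𝓝[>] 0) y} = S := by
  ext P
  change ClusterPt P (map y (𝓝[>] 0)) ↔ P ∈ S
  rw [((nhdsGT_basis (0 : ℝ)).map y).clusterPt_iff_forall_mem_closure]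
  constructor
  · intro hP
    have h := hP b hb
    rwa [hy b ⟨hb, le_rfl⟩, hS.closure_eq] at h
  · intro hP δ hδ
    rw [← hy (min δ b) ⟨lt_min hδ hb, min_le_right _ _⟩] at hP
    exact subset_closure (image_mono (Ioo_subset_Ioo_right (min_le_left _ _)) hP)

theorem eq_of_mapClusterPt_of_tendsto [T2Space X] {α : Type*} {l : Filter α} {x : α → X} {P P' : X}
    (hP : MapClusterPt P l x) (hP' : Tendsto x l (𝓝 P')) : P = P' :=
  haveI : (𝓝 P ⊓ 𝓝 P').NeBot := NeBot.mono hP (inf_le_inf_left _ hP')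
  eq_of_nhds_neBot this

end ClusterPoints

section CircleMotion

variable {n : ℕ}

variable (e : PseudoBasis n) {μ : ℝ}

theorem isLightlike_poleRot_o (hμ : 1 - 2 * μ < 0) (u : ℝ) : IsLightlike (poleRot e μ u e.o) :=
  IsLightlike.map ⟨e.o_ne_zero, e.o_o⟩ (isLorentz_poleRot e hμ u)

theorem isCompact_orbit (hμ : 1 - 2 * μ < 0) : IsCompact (range fun u => poleRot e μ u e.o) :=
  ((periodic_poleRot e hμ).comp fun G => G e.o).compact_of_continuous (polePeriod_pos hμ).ne'
    ((continuous_poleRot e hμ).clm_apply continuous_const)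

/-- The motion of the point `⟨o⟩` under the rotations generated by the pure pole form, transported
by `A`. -/
def circleMotion (μ : ℝ) (A : EndM n) (u : ℝ) : Amb n := pt (A (poleRot e μ u e.o))

theorem periodic_circleMotion (hμ : 1 - 2 * μ < 0) (A : EndM n) :
    Function.Periodic (circleMotion e μ A) (polePeriod μ) :=
  (periodic_poleRot e hμ).comp fun G => pt (A (G e.o))

variable {A : EndM n}

theorem norm_circleMotion (hμ : 1 - 2 * μ < 0) (hA : IsLorentz A) (u : ℝ) :
    ‖circleMotion e μ A u‖ = 1 :=
  ((isLightlike_poleRot_o e hμ u).map hA).norm_pt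

theorem tendsto_dist_circleMotion (hμ : 1 - 2 * μ < 0) {α : Type*} {l : Filter α} {G : α → EndM n}
    (hA : IsLorentz A) (hG : Tendsto G l (𝓝 A)) (w : α → ℝ) :
    Tendsto (fun t => dist (circleMotion e μ (G t) (w t)) (circleMotion e μ A (w t))) l (𝓝 0) :=
  tendsto_dist_of_isCompact (f := fun (B : EndM n) x => pt (B x)) (isCompact_orbit e hμ)
    (by
      rintro _ ⟨u, rfl⟩
      exact ContinuousAt.comp (f := fun z : EndM n × Mink n => z.1 z.2)
        (continuousAt_pt ((isLightlike_poleRot_o e hμ u).map hA).zero_ne) (by fun_prop))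
    hG fun t => mem_range_self (w t)

theorem range_circleMotion (hμ : 1 - 2 * μ < 0) (hA : IsLorentz A) :
    range (circleMotion e μ A) =
      sphereOf ((Submodule.span ℝ {e.o, e.ι, e.τ}).map A.toLinearMap) := by
  ext P
  constructor
  · rintro ⟨u, rfl⟩
    have hlight := (isLightlike_poleRot_o e hμ u).map hA
    exact ⟨_, ⟨_, poleRot_o_mem e μ u, rfl⟩, hlight.1, hlight.2, rfl⟩
  · rintro ⟨_, ⟨x, hx, rfl⟩, hx₀, hxx, rfl⟩
    have hx₀' : x ≠ 0 := fun h => hx₀ (by rw [h, map_zero])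
    obtain ⟨u, r, hr, rfl⟩ :=
      exists_smul_poleRot_o_eq e hμ hx hx₀' ((hA x x).symm.trans hxx)
    exact ⟨u, ((congrArg pt (map_smul A r _)).trans (pt_smul hr _)).symm⟩

theorem hasDerivAt_apply_poleRot_o (hμ : 1 - 2 * μ < 0) (A : EndM n) (u : ℝ) :
    HasDerivAt (fun v => A (poleRot e μ v e.o)) (A (poleRot e μ u (e.τ - e.o))) u := by
  rw [← poleGen_o e (μ := μ)]
  have h := (hasDerivAt_poleRot e hμ u).clm_apply (hasDerivAt_const u e.o)
  simp only [map_zero, add_zero] at h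
  exact A.hasFDerivAt.comp_hasDerivAt u h

theorem norm_deriv_circleMotion (hμ : 1 - 2 * μ < 0) (hA : IsLorentz A) (u : ℝ) :
    ‖deriv (circleMotion e μ A) u‖ = |A (poleRot e μ u e.o) 0|⁻¹ := by
  have hτo : mink (e.τ - e.o) (e.τ - e.o) = 1 := by
    simp only [mink_sub_left, mink_sub_right, e.o_o, e.τ_τ, e.o_τ, mink_comm e.τ e.o]
    norm_num
  refine (norm_deriv_pt (hasDerivAt_apply_poleRot_o e hμ A u)
    (Eventually.of_forall fun v => (isLightlike_poleRot_o e hμ v).map hA)).trans ?_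
  rw [hA, isLorentz_poleRot e hμ, hτo, Real.sqrt_one, one_div]

theorem norm_deriv_circleMotion_pos (hμ : 1 - 2 * μ < 0) (hA : IsLorentz A) (u : ℝ) :
    0 < ‖deriv (circleMotion e μ A) u‖ := by
  rw [norm_deriv_circleMotion e hμ hA]
  exact inv_pos.2 (abs_pos.2 ((isLightlike_poleRot_o e hμ u).map hA).zero_ne)

theorem hasDerivAt_circleMotion (hμ : 1 - 2 * μ < 0) (hA : IsLorentz A) (u : ℝ) :
    HasDerivAt (circleMotion e μ A) (deriv (circleMotion e μ A) u) u :=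
  (differentiableAt_of_deriv_ne_zero
    (norm_pos_iff.1 (norm_deriv_circleMotion_pos e hμ hA u))).hasDerivAt

theorem continuous_circleMotion (hμ : 1 - 2 * μ < 0) (hA : IsLorentz A) :
    Continuous (circleMotion e μ A) :=
  continuous_iff_continuousAt.2 fun u => (hasDerivAt_circleMotion e hμ hA u).continuousAt

theorem isClosed_range_circleMotion (hμ : 1 - 2 * μ < 0) (hA : IsLorentz A) :
    IsClosed (range (circleMotion e μ A)) :=
  ((periodic_circleMotion e hμ A).compact_of_continuous (polePeriod_pos hμ).ne'
    (continuous_circleMotion e hμ hA)).isClosed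

theorem not_range_circleMotion_subset_singleton (hμ : 1 - 2 * μ < 0) (hA : IsLorentz A)
    (P : Amb n) : ¬ range (circleMotion e μ A) ⊆ {P} := by
  intro h
  have hconst : circleMotion e μ A = fun _ => P := funext fun u => h (mem_range_self u)
  have hpos := norm_deriv_circleMotion_pos e hμ hA 0
  rw [hconst, deriv_const, norm_zero] at hpos
  exact hpos.false

theorem exists_pos_le_speed_circleMotion (hμ : 1 - 2 * μ < 0) (hA : IsLorentz A) {φ : Amb n → ℝ}
    (hφ : IsConformalFactor φ) :
    ∃ m > 0, ∀ u, m ≤ φ (circleMotion e μ A u) * ‖deriv (circleMotion e μ A) u‖ := by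
  have hmem (u : ℝ) : circleMotion e μ A u ∈ Metric.sphere 0 1 :=
    mem_sphere_zero_iff_norm.2 (norm_circleMotion e hμ hA u)
  refine exists_pos_forall_le_of_periodic (T := polePeriod μ) (fun u => ?_) (polePeriod_pos hμ).ne'
    ?_ fun u => mul_pos (hφ.2 _ (hmem u)) (norm_deriv_circleMotion_pos e hμ hA u)
  · simp only [norm_deriv_circleMotion e hμ hA, periodic_circleMotion e hμ A u,
      periodic_poleRot e hμ u]
  · simp only [norm_deriv_circleMotion e hμ hA]
    refine (hφ.1.comp_continuous (continuous_circleMotion e hμ hA) hmem).mul (Continuous.inv₀ ?_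
      fun u => abs_ne_zero.2 ((isLightlike_poleRot_o e hμ u).map hA).zero_ne)
    have hrot := continuous_poleRot e hμ
    fun_prop

theorem tendsto_speed_circleMotion (hμ : 1 - 2 * μ < 0) (hA : IsLorentz A) {φ : Amb n → ℝ}
    (hφ : IsConformalFactor φ) {l : Filter ℝ} {w w' : ℝ → ℝ}
    (hw : ∀ᶠ t in l, HasDerivAt w (w' t) t) (hw' : Tendsto w' l atTop) :
    Tendsto (fun t => φ (circleMotion e μ A (w t)) *
      ‖deriv (fun v => circleMotion e μ A (w v)) t‖) l atTop := by
  obtain ⟨m, hm, hle⟩ := exists_pos_le_speed_circleMotion e hμ hA hφ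
  refine tendsto_atTop_mono' l ?_ (hw'.atTop_mul_const hm)
  filter_upwards [hw, hw'.eventually_ge_atTop 0] with t ht hpos
  have hd := (hasDerivAt_circleMotion e hμ hA (w t)).scomp t ht
  calc w' t * m
      ≤ w' t * (φ (circleMotion e μ A (w t)) * ‖deriv (circleMotion e μ A) (w t)‖) := by
        gcongr
        exact hle (w t)
    _ = φ (circleMotion e μ A (w t)) * ‖deriv (fun v => circleMotion e μ A (w v)) t‖ := by
        rw [show deriv (fun v => circleMotion e μ A (w v)) t = _ from hd.deriv, norm_smul,
          Real.norm_of_nonneg hpos]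
        ring

end CircleMotion

section LogParam

variable {b p q : ℝ} {Q s : ℝ → ℝ}

namespace IsNormalParam

theorem hasDerivAt (h : IsNormalParam b Q q s) {t : ℝ} (ht : t ∈ Ico 0 b) :
    HasDerivAt s (deriv s t) t := by
  obtain ⟨⟨δ, hδ, hs, -⟩, -⟩ := h
  exact hasDerivAt_of_contDiffOn hs isOpen_Ioo ⟨by linarith [ht.1], ht.2⟩

theorem continuousAt_deriv (h : IsNormalParam b Q q s) {t : ℝ} (ht : t ∈ Ico 0 b) :
    ContinuousAt (deriv s) t := by
  obtain ⟨⟨δ, hδ, hs, -⟩, -⟩ := h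
  exact (contDiffOn_deriv hs isOpen_Ioo).continuousOn.continuousAt
    (isOpen_Ioo.mem_nhds ⟨by linarith [ht.1], ht.2⟩)

theorem deriv_pos (h : IsNormalParam b Q q s) {t : ℝ} (ht : t ∈ Ico 0 b) : 0 < deriv s t := by
  obtain ⟨⟨δ, hδ, -, hpos⟩, -⟩ := h
  exact hpos t ⟨by linarith [ht.1], ht.2⟩

theorem pos (h : IsNormalParam b Q q s) {t : ℝ} (ht : t ∈ Ioo 0 b) : 0 < s t := by
  have hmono : StrictMonoOn s (Ico 0 b) := by
    refine strictMonoOn_of_deriv_pos (convex_Ico 0 b)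
      (fun t ht => (h.hasDerivAt ht).continuousAt.continuousWithinAt) fun t ht => ?_
    exact h.deriv_pos (interior_subset ht)
  rw [← h.2.1]
  exact hmono ⟨le_rfl, ht.1.trans ht.2⟩ ⟨ht.1.le, ht.2⟩ ht.1

theorem tendsto_nhdsGT_zero (h : IsNormalParam b Q q s) (hb : 0 < b) :
    Tendsto s (𝓝[>] 0) (𝓝[>] 0) := by
  refine tendsto_nhdsWithin_iff.2 ⟨?_, eventually_of_mem (Ioo_mem_nhdsGT hb) fun t ht => h.pos ht⟩
  have hcont := (h.hasDerivAt ⟨le_rfl, hb⟩).continuousAt.tendsto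
  rw [h.2.1] at hcont
  exact hcont.mono_left nhdsWithin_le_nhds

theorem tendsto_deriv_div (h : IsNormalParam b Q q s) (hb : 0 < b) :
    Tendsto (fun t => deriv s t / s t) (𝓝[>] 0) atTop := by
  simp only [div_eq_mul_inv]
  exact ((h.continuousAt_deriv ⟨le_rfl, hb⟩).tendsto.mono_left nhdsWithin_le_nhds).pos_mul_atTop
    (h.deriv_pos ⟨le_rfl, hb⟩) (tendsto_inv_nhdsGT_zero.comp (h.tendsto_nhdsGT_zero hb))

theorem continuousOn (h : IsNormalParam b Q q s) : ContinuousOn s (Ioo 0 b) := fun _ ht =>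
  (h.hasDerivAt (Ioo_subset_Ico_self ht)).continuousAt.continuousWithinAt

theorem continuousOn_deriv (h : IsNormalParam b Q q s) : ContinuousOn (deriv s) (Ioo 0 b) :=
  fun _ ht => (h.continuousAt_deriv (Ioo_subset_Ico_self ht)).continuousWithinAt

end IsNormalParam

/-- The parameter `log (s / s(p))`, in which the pure pole form is constant. -/
def logParam (s : ℝ → ℝ) (p t : ℝ) : ℝ := Real.log (s t / s p)

theorem logParam_self (h : IsNormalParam b Q q s) (hp : p ∈ Ioo 0 b) : logParam s p p = 0 := by
  rw [logParam, div_self (h.pos hp).ne', Real.log_one]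

theorem hasDerivAt_logParam (h : IsNormalParam b Q q s) (hp : p ∈ Ioo 0 b) {t : ℝ}
    (ht : t ∈ Ioo 0 b) : HasDerivAt (logParam s p) (deriv s t / s t) t := by
  have hst := (h.pos ht).ne'
  have hsp := (h.pos hp).ne'
  refine (((h.hasDerivAt (Ioo_subset_Ico_self ht)).div_const (s p)).log
    (div_ne_zero hst hsp)).congr_deriv ?_
  field_simp

theorem continuousOn_logParam (h : IsNormalParam b Q q s) (hp : p ∈ Ioo 0 b) :
    ContinuousOn (logParam s p) (Ioo 0 b) := fun _ ht =>
  (hasDerivAt_logParam h hp ht).continuousAt.continuousWithinAt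

theorem tendsto_logParam_atBot (h : IsNormalParam b Q q s) (hp : p ∈ Ioo 0 b) :
    Tendsto (logParam s p) (𝓝[>] 0) atBot := by
  have hb : 0 < b := hp.1.trans hp.2
  have hsp := h.pos hp
  refine Real.tendsto_log_nhdsGT_zero.comp (tendsto_nhdsWithin_iff.2 ⟨?_, ?_⟩)
  · simpa only [zero_div] using
      (tendsto_nhdsWithin_iff.1 (h.tendsto_nhdsGT_zero hb)).1.div_const (s p)
  · filter_upwards [Ioo_mem_nhdsGT hb] with t ht
    exact div_pos (h.pos ht) hsp

variable {n : ℕ} (e : PseudoBasis n) {μ : ℝ}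

theorem continuousOn_poleForm (h : IsNormalParam b Q q s) :
    ContinuousOn (poleForm s e μ) (Ioo 0 b) := by
  rw [funext (poleForm_eq e μ s)]
  exact (h.continuousOn_deriv.div h.continuousOn fun t ht => (h.pos ht).ne').smul
    continuousOn_const

theorem gam_poleForm (h : IsNormalParam b Q q s) (hp : p ∈ Ioo 0 b) (hμ : 1 - 2 * μ < 0) {t : ℝ}
    (ht : t ∈ Ioo 0 b) : Gam b (poleForm s e μ) p t = poleRot e μ (logParam s p t) := by
  have hprim : IsPrimitive b (poleForm s e μ) p fun t => poleRot e μ (logParam s p t) := by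
    refine ⟨?_, fun t ht => ?_⟩
    · simp only [logParam_self h hp, poleRot, rodrigues_zero]
    · refine ((hasDerivAt_poleRot e hμ _).scomp t (hasDerivAt_logParam h hp ht)).congr_deriv ?_
      rw [poleForm_eq]
      exact (mul_smul_comm _ _ _).symm
  exact (gam_spec (continuousOn_poleForm e h) hp).eqOn (continuousOn_poleForm e h) hp hprim ht

end LogParam

/-! ### The limit of the Calapso transforms -/

section Limit

variable {n : ℕ} {b p q lam : ℝ} {c : ℝ → Mink n} {Q s : ℝ → ℝ} {e : PseudoBasis n}
  {F : ℝ → EndM n} {I : Set ℝ}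

theorem IsNormalParam.exists_isParamCurve {ε : ℝ} (hs : IsNormalParam b Q q s) (hε : 0 < ε)
    (hc : IsRegularLift c (Ioo (-ε) b)) : ∃ I, IsParamCurve c s I ∧ Ico 0 b ⊆ I := by
  obtain ⟨⟨δ, hδ, hsmooth, hpos⟩, -, -⟩ := hs
  have hIε : Ioo (-min ε δ) b ⊆ Ioo (-ε) b := Ioo_subset_Ioo_left (neg_le_neg (min_le_left _ _))
  have hIδ : Ioo (-min ε δ) b ⊆ Ioo (-δ) b := Ioo_subset_Ioo_left (neg_le_neg (min_le_right _ _))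
  exact ⟨Ioo (-min ε δ) b, ⟨isOpen_Ioo, ⟨hc.1.mono hIε, fun t ht => hc.2 t (hIε ht)⟩,
    hsmooth.mono hIδ, fun t ht => hpos t (hIδ ht)⟩,
    Ico_subset_Ioo_left (neg_lt_zero.2 (lt_min hε hδ))⟩

theorem IsParamCurve.restrict (h : IsParamCurve c s I) (hI : Ico 0 b ⊆ I) :
    IsParamCurve c s (Ioo 0 b) :=
  h.mono isOpen_Ioo (Ioo_subset_Ico_self.trans hI)

theorem IsCurveFrame.norm_regularPart_le (hF : IsCurveFrame b c s e F)
    (h : IsParamCurve c s (Ioo 0 b)) {t : ℝ} (ht : t ∈ Ioo 0 b) (hn : 1 ≤ n) :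
    ‖regularPart c s F t‖ ≤
      √(mink (paramDeriv s (flatDual c s) t) (paramDeriv s (flatDual c s) t)) *
        (‖e.τ‖ + ∑ i, ‖e.ν i‖) := by
  rw [← hF.apply_regularPart ht, hF.isLorentz ht]
  exact e.norm_le_of_orthogonal hn (hF.mink_o_regularPart h ht) (hF.mink_ι_regularPart h ht hn)

theorem IsCurveFrame.tendsto_gaugeRemainder (hF : IsCurveFrame b c s e F) (hn : 1 ≤ n)
    (hb : 0 < b) (hs : IsNormalParam b Q q s) (h : IsParamCurve c s I) (hI : Ico 0 b ⊆ I) :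
    Tendsto (gaugeRemainder c s e F) (𝓝[>] 0) (𝓝 0) := by
  have h0 : (0 : ℝ) ∈ Ico 0 b := left_mem_Ico.2 hb
  have hdual : ContinuousAt (paramDeriv s (flatDual c s)) 0 :=
    (h.contDiffOn_paramDeriv h.contDiffOn_flatDual).continuousOn.continuousAt
      (h.isOpen.mem_nhds (hI h0))
  have hbdd : IsBoundedUnder (· ≤ ·) (𝓝[>] 0) fun t => ‖regularPart c s F t‖ := by
    have hlim := (((tendsto_mink hdual hdual).sqrt).mul_const (‖e.τ‖ + ∑ i, ‖e.ν i‖)).mono_left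
      (nhdsWithin_le_nhds (s := Ioi 0))
    refine hlim.isBoundedUnder_le.mono_le ?_
    filter_upwards [Ioo_mem_nhdsGT hb] with t ht
      using hF.norm_regularPart_le (h.restrict hI) ht hn
  have hss : Tendsto (fun t => deriv s t * s t) (𝓝[>] 0) (𝓝 0) := by
    have hlim := ((hs.continuousAt_deriv h0).mul (hs.hasDerivAt h0).continuousAt).tendsto
    rw [Pi.mul_apply, hs.2.1, mul_zero] at hlim
    exact hlim.mono_left nhdsWithin_le_nhds
  have hwedge := ((wedgeMap n e.o).continuous.tendsto 0).comp
    (hss.zero_smul_isBoundedUnder_le hbdd)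
  refine (hwedge.neg.congr fun t => ?_).trans_eq ?_
  · simp only [Function.comp_apply, wedgeMap_apply, wedge_smul_right, gaugeRemainder]
  · rw [map_zero, neg_zero]

theorem IsCurveFrame.continuousOn_gaugeRemainder (hF : IsCurveFrame b c s e F)
    (h : IsParamCurve c s (Ioo 0 b)) : ContinuousOn (gaugeRemainder c s e F) (Ioo 0 b) := by
  have hdual := (h.contDiffOn_paramDeriv h.contDiffOn_flatDual).continuousOn
  have hreg : ContinuousOn (regularPart c s F) (Ioo 0 b) :=
    (continuous_minkAdjoint.comp_continuousOn hF.1.continuousOn).clm_apply hdual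
  have hs' := (contDiffOn_deriv h.smooth h.isOpen).continuousOn
  exact ((hs'.mul h.smooth.continuousOn).smul
    ((wedgeMap n e.o).continuous.comp_continuousOn hreg)).neg

theorem IsNormalParam.continuousOn_assocForm (hs : IsNormalParam b Q q s)
    (h : IsParamCurve c s (Ioo 0 b)) : ContinuousOn (assocForm c Q) (Ioo 0 b) := by
  have hQ : ContinuousOn Q (Ioo 0 b) :=
    ((continuousOn_const.mul (hs.continuousOn_deriv.pow 2)).div (hs.continuousOn.pow 2)
      fun t ht => pow_ne_zero 2 (hs.pos ht).ne').congr hs.2.2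
  exact ((hQ.div hs.continuousOn_deriv fun t ht => (h.deriv_pos t ht).ne').smul
    (contDiffOn_wedge h.contDiffOn_flatLift h.contDiffOn_flatTangent).continuousOn).congr
      fun t ht => h.assocForm_eq ht Q

theorem isSkew_poleForm (s : ℝ → ℝ) (e : PseudoBasis n) (μ t : ℝ) : IsSkew (poleForm s e μ t) :=
  (isSkew_wedge _ _).smul _

theorem IsNormalParam.commute_gam_poleForm {μ t : ℝ} (hs : IsNormalParam b Q q s)
    (hp : p ∈ Ioo 0 b) (hμ : 1 - 2 * μ < 0) (ht : t ∈ Ioo 0 b) :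
    Commute (Gam b (poleForm s e μ) p t) (poleForm s e μ t) := by
  rw [gam_poleForm e hs hp hμ ht, poleForm_eq]
  exact (commute_poleRot_poleGen e _).smul_right _

/-- The form `Φ`, which describes the Calapso transforms relative to the circular motion. -/
def regularForm (b : ℝ) (c : ℝ → Mink n) (Q s : ℝ → ℝ) (e : PseudoBasis n) (F : ℝ → EndM n)
    (q lam p : ℝ) : ℝ → EndM n :=
  gaugeBy b (poleForm s e (q * lam)) p (gauge (singFrame s e F) (lam • assocForm c Q))

section RegularForm

variable (hn : 1 ≤ n) (hs : IsNormalParam b Q q s) (hp : p ∈ Ioo 0 b)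
  (hμ : 1 - 2 * (q * lam) < 0) (hF : IsCurveFrame b c s e F)
include hn hs hp hμ hF

section Interior

variable (h : IsParamCurve c s (Ioo 0 b))
include h

theorem regularForm_eq {t : ℝ} (ht : t ∈ Ioo 0 b) :
    regularForm b c Q s e F q lam p t = poleRot e (q * lam) (logParam s p t) *
      gaugeRemainder c s e F t * minkAdjoint (poleRot e (q * lam) (logParam s p t)) := by
  rw [regularForm, gaugeBy_eq (continuousOn_poleForm e hs) (fun t _ => isSkew_poleForm s e _ t) hp
      (fun t ht => hs.commute_gam_poleForm hp hμ ht) _ ht,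
    hF.gauge_singFrame h ht hn lam (hs.pos ht).ne' (hs.2.2 t ht), add_sub_cancel_left,
    gam_poleForm e hs hp hμ ht]

theorem isSkew_regularForm {t : ℝ} (ht : t ∈ Ioo 0 b) :
    IsSkew (regularForm b c Q s e F q lam p t) := by
  rw [regularForm_eq hn hs hp hμ hF h ht]
  exact isSkew_gaugeRemainder.conj _

theorem continuousOn_regularForm :
    ContinuousOn (regularForm b c Q s e F q lam p) (Ioo 0 b) := by
  have hrot : ContinuousOn (fun t => poleRot e (q * lam) (logParam s p t)) (Ioo 0 b) :=
    (continuous_poleRot e hμ).comp_continuousOn (continuousOn_logParam hs hp)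
  exact ((hrot.mul (hF.continuousOn_gaugeRemainder h)).mul
    (continuous_minkAdjoint.comp_continuousOn hrot)).congr
      fun t ht => regularForm_eq hn hs hp hμ hF h ht

theorem isPrimitive_gam_regularForm : IsPrimitive b (regularForm b c Q s e F q lam p) p
    (Gam b (regularForm b c Q s e F q lam p) p) :=
  gam_spec (continuousOn_regularForm hn hs hp hμ hF h) hp

theorem isLorentz_gam_regularForm {t : ℝ} (ht : t ∈ Ioo 0 b) :
    IsLorentz (Gam b (regularForm b c Q s e F q lam p) p t) :=
  (isPrimitive_gam_regularForm hn hs hp hμ hF h).isLorentz hp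
    (fun _ ht => isSkew_regularForm hn hs hp hμ hF h ht) ht

theorem gam_assocForm_mul_singFrame {t : ℝ} (ht : t ∈ Ioo 0 b) :
    Gam b (lam • assocForm c Q) p t * singFrame s e F t = singFrame s e F p *
      (Gam b (regularForm b c Q s e F q lam p) p t * poleRot e (q * lam) (logParam s p t)) := by
  have hgauge : ContinuousOn (gauge (singFrame s e F) (lam • assocForm c Q)) (Ioo 0 b) :=
    ((continuousOn_poleForm e hs).add (hF.continuousOn_gaugeRemainder h)).congr
      fun t ht => hF.gauge_singFrame h ht hn lam (hs.pos ht).ne' (hs.2.2 t ht)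
  rw [← gam_poleForm e hs hp hμ ht]
  exact gam_mul_eq_mul_gam_mul_gam (continuousOn_poleForm e hs)
    (fun t _ => isSkew_poleForm s e _ t) hp (fun t ht => hs.commute_gam_poleForm hp hμ ht)
    ((hs.continuousOn_assocForm h).const_smul lam)
    (fun t ht => isLorentz_singFrame (hF.isLorentz ht) (hs.pos ht).ne')
    (fun t ht => hasDerivAt_singFrame (hF.hasDerivAt_deriv ht)
      (hs.hasDerivAt (Ioo_subset_Ico_self ht)) (hs.pos ht).ne')
    hgauge (continuousOn_regularForm hn hs hp hμ hF h) ht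

theorem pt_calapso_eq {t : ℝ} (ht : t ∈ Ioo 0 b) :
    pt (calapso b c Q lam p t) = circleMotion e (q * lam)
      (singFrame s e F p * Gam b (regularForm b c Q s e F q lam p) p t) (logParam s p t) := by
  have hs₀ := (hs.pos ht).ne'
  have hscale : deriv s t / √(mink (deriv c t) (deriv c t)) ≠ 0 :=
    (div_pos (h.deriv_pos t ht) (Real.sqrt_pos.2 (h.lift.2 t ht).2.2)).ne'
  have hlift : Gam b (lam • assocForm c Q) p t (flatLift c s t) = s t •
      (singFrame s e F p * Gam b (regularForm b c Q s e F q lam p) p t)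
        (poleRot e (q * lam) (logParam s p t) e.o) := by
    rw [← hF.apply_o ht, ← singFrame_smul_o hs₀, ← mul_apply_eq_comp,
      gam_assocForm_mul_singFrame hn hs hp hμ hF h ht, map_smul]
    rfl
  calc pt (calapso b c Q lam p t)
      = pt (Gam b (lam • assocForm c Q) p t (flatLift c s t)) := by
        rw [flatLift, map_smul, pt_smul hscale, calapso]
    _ = _ := by rw [hlift, pt_smul hs₀, circleMotion]

end Interior

section Boundary

variable (h : IsParamCurve c s I) (hI : Ico 0 b ⊆ I)
include h hI

theorem tendsto_regularForm :
    Tendsto (regularForm b c Q s e F q lam p) (𝓝[>] 0) (𝓝 0) := by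
  have hb : 0 < b := hp.1.trans hp.2
  have hrot {f : EndM n → EndM n} (hf : Continuous f) : IsBoundedUnder (· ≤ ·) (𝓝[>] 0)
      fun t => ‖f (poleRot e (q * lam) (logParam s p t))‖ := by
    obtain ⟨M, hM⟩ := ((periodic_poleRot e hμ).comp f).isBounded_of_continuous
      (polePeriod_pos hμ).ne' (hf.comp (continuous_poleRot e hμ)) |>.exists_norm_le
    exact isBoundedUnder_of ⟨M, fun t => hM _ (mem_range_self (logParam s p t))⟩
  refine Tendsto.congr' ?_ ((isBoundedUnder_le_mul_tendsto_zero (hrot continuous_id)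
    (hF.tendsto_gaugeRemainder hn hb hs h hI)).zero_mul_isBoundedUnder_le
      (hrot continuous_minkAdjoint))
  filter_upwards [Ioo_mem_nhdsGT hb] with t ht
    using (regularForm_eq hn hs hp hμ hF (h.restrict hI) ht).symm

theorem exists_tendsto_gam_regularForm :
    ∃ Γ₀, Tendsto (Gam b (regularForm b c Q s e F q lam p) p) (𝓝[>] 0) (𝓝 Γ₀) ∧
      IsLorentz Γ₀ := by
  have hr := h.restrict hI
  obtain ⟨Γ₀, hΓ₀⟩ := (isPrimitive_gam_regularForm hn hs hp hμ hF hr).exists_tendsto hp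
    (continuousOn_regularForm hn hs hp hμ hF hr) (tendsto_regularForm hn hs hp hμ hF h hI)
  refine ⟨Γ₀, hΓ₀, IsLorentz.of_tendsto ?_ hΓ₀⟩
  filter_upwards [Ioo_mem_nhdsGT (hp.1.trans hp.2)] with t ht
    using isLorentz_gam_regularForm hn hs hp hμ hF hr ht

end Boundary

end RegularForm

end Limit

/-! ### Curves asymptotic to a motion on the limit circle -/

section Asymptotics

variable {n : ℕ} {b p q μ : ℝ} {Q s : ℝ → ℝ} {e : PseudoBasis n} {A : EndM n} {x y : ℝ → Amb n}
  (hs : IsNormalParam b Q q s) (hp : p ∈ Ioo 0 b) (hμ : 1 - 2 * μ < 0) (hA : IsLorentz A)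
  (hy : EqOn y (fun t => circleMotion e μ A (logParam s p t)) (Ioo 0 b))
include hs hp hμ hA hy

theorem image_motion_eq {δ : ℝ} (hδ : δ ∈ Ioc 0 b) :
    y '' Ioo 0 δ = sphereOf ((Submodule.span ℝ {e.o, e.ι, e.τ}).map A.toLinearMap) := by
  have hδb : Ioo 0 δ ⊆ Ioo 0 b := Ioo_subset_Ioo_right hδ.2
  rw [(hy.mono hδb).image_eq, ← range_circleMotion e hμ hA]
  exact image_comp_eq_range_of_periodic (periodic_circleMotion e hμ A) (polePeriod_pos hμ) hδ.1
    ((continuousOn_logParam hs hp).mono hδb) (tendsto_logParam_atBot hs hp)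

theorem tendsto_speed_motion {φ : Amb n → ℝ} (hφ : IsConformalFactor φ) :
    Tendsto (fun t => φ (y t) * ‖deriv y t‖) (𝓝[>] 0) atTop := by
  have hb : 0 < b := hp.1.trans hp.2
  have hlog : ∀ᶠ t in 𝓝[>] 0, HasDerivAt (logParam s p) (deriv s t / s t) t := by
    filter_upwards [Ioo_mem_nhdsGT hb] with t ht using hasDerivAt_logParam hs hp ht
  refine (tendsto_speed_circleMotion e hμ hA hφ hlog (hs.tendsto_deriv_div hb)).congr' ?_
  filter_upwards [Ioo_mem_nhdsGT hb] with t ht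
  rw [hy ht, hy.deriv isOpen_Ioo ht]

variable {G : ℝ → EndM n} (hGA : Tendsto G (𝓝[>] 0) (𝓝 A))
  (hx : EqOn x (fun t => circleMotion e μ (G t) (logParam s p t)) (Ioo 0 b))
include hGA hx

omit hs in
theorem tendsto_dist_motion : Tendsto (fun t => dist (x t) (y t)) (𝓝[>] 0) (𝓝 0) := by
  refine (tendsto_dist_circleMotion e hμ hA hGA (logParam s p)).congr' ?_
  filter_upwards [Ioo_mem_nhdsGT (hp.1.trans hp.2)] with t ht
  rw [hx ht, hy ht]

omit hs in
theorem tendsto_conformalDist_motion (hG : ∀ t ∈ Ioo 0 b, IsLorentz (G t)) {φ : Amb n → ℝ}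
    (hφ : IsConformalFactor φ) :
    Tendsto (fun t => conformalDist φ (x t) (y t)) (𝓝[>] 0) (𝓝 0) := by
  have hnear : ∀ᶠ t in 𝓝[>] 0, t ∈ Ioo 0 b := Ioo_mem_nhdsGT (hp.1.trans hp.2)
  refine tendsto_conformalDist hφ (hnear.mono fun t ht => ?_) (hnear.mono fun t ht => ?_)
    (tendsto_dist_motion hp hμ hA hy hGA hx)
  · rw [hx ht, norm_circleMotion e hμ (hG t ht)]
  · rw [hy ht, norm_circleMotion e hμ hA]

theorem setOf_mapClusterPt_motion : {P | MapClusterPt P (𝓝[>] 0) x} =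
    sphereOf ((Submodule.span ℝ {e.o, e.ι, e.τ}).map A.toLinearMap) := by
  have hclosed := isClosed_range_circleMotion e hμ hA
  rw [range_circleMotion e hμ hA] at hclosed
  simp only [mapClusterPt_iff_of_tendsto_dist (tendsto_dist_motion hp hμ hA hy hGA hx)]
  exact setOf_mapClusterPt_nhdsGT_eq hclosed (hp.1.trans hp.2)
    fun δ hδ => image_motion_eq hs hp hμ hA hy hδ

theorem not_exists_tendsto_motion : ¬∃ P, Tendsto x (𝓝[>] 0) (𝓝 P) := by
  rintro ⟨P, hP⟩
  refine not_range_circleMotion_subset_singleton e hμ hA P fun P' hP' => ?_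
  rw [range_circleMotion e hμ hA, ← setOf_mapClusterPt_motion hs hp hμ hA hy hGA hx] at hP'
  exact eq_of_mapClusterPt_of_tendsto hP' hP

end Asymptotics

end Calapso

end

open Calapso in
theorem theorem5p4 (n : ℕ) (hn : 1 ≤ n) (b ε : ℝ) (hb : 0 < b) (hε : 0 < ε)
    (c : ℝ → Mink n) (hc : IsRegularLift c (Ioo (-ε) b))
    (Q : ℝ → ℝ) (hQ : ∀ t ∈ Ioo 0 b, Q t ≠ 0) (q : ℝ) (hpole : HasPole 2 b Q q)
    (lam : ℝ) (hlam : 1 - 2 * (q * lam) < 0) (p : ℝ) (hp : p ∈ Ioo 0 b) (e : PseudoBasis n) :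
    (∃ s, IsNormalParam b Q q s) ∧
    ∀ s, IsNormalParam b Q q s →
      (∃ F, IsCurveFrame b c s e F) ∧
      ∀ F, IsCurveFrame b c s e F →
        let g := singFrame s e F
        let ξ := poleForm s e (q * lam)
        let Φ := gaugeBy b ξ p (gauge g (lam • assocForm c Q))
        ∃ Γ₀ : EndM n, Tendsto (Gam b Φ p) (𝓝[>] 0) (𝓝 Γ₀) ∧ IsLorentz Γ₀ ∧
          let C : ℝ → Mink n := fun t => g p (Γ₀ (Gam b ξ p t e.o))
          let circle : Set (Amb n) := sphereOf
            ((Submodule.span ℝ {e.o, e.ι, e.τ}).map (g p * Γ₀).toLinearMap)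
          -- the Calapso transform tends towards `⟨C⟩` for all representative metrics
          (∀ φ : Amb n → ℝ, IsConformalFactor φ →
            Tendsto (fun t => conformalDist φ (pt (calapso b c Q lam p t)) (pt (C t)))
              (𝓝[>] 0) (𝓝 0)) ∧
          -- `⟨C⟩` is a motion on the circle, which it traverses completely in every `(0, δ)`
          (∀ δ ∈ Ioc 0 b, (fun t => pt (C t)) '' Ioo 0 δ = circle) ∧
          -- the speed of `⟨C⟩` tends to infinity for all representative metrics
          (∀ φ : Amb n → ℝ, IsConformalFactor φ →
            Tendsto (fun t => φ (pt (C t)) * ‖deriv (fun u => pt (C u)) t‖) (𝓝[>] 0) atTop) ∧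
          -- the Calapso transform has no limit point, but the limit circle
          (¬ ∃ P, Tendsto (fun t => pt (calapso b c Q lam p t)) (𝓝[>] 0) (𝓝 P)) ∧
          {P | MapClusterPt P (𝓝[>] 0) (fun t => pt (calapso b c Q lam p t))} = circle := by
  refine ⟨exists_isNormalParam hb hQ hpole, fun s hs => ?_⟩
  obtain ⟨I, h, hI⟩ := hs.exists_isParamCurve hε hc
  have hr := h.restrict hI
  refine ⟨exists_isCurveFrame hn hr hp e, fun F hF => ?_⟩
  intro g ξ Φ
  obtain ⟨Γ₀, hΓ₀, hΓ₀L⟩ := exists_tendsto_gam_regularForm hn hs hp hlam hF h hI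
  refine ⟨Γ₀, hΓ₀, hΓ₀L, ?_⟩
  intro C circle
  have hg : IsLorentz (g p) := isLorentz_singFrame (hF.isLorentz hp) (hs.pos hp).ne'
  have hA : IsLorentz (g p * Γ₀) := hg.mul hΓ₀L
  have hG : ∀ t ∈ Ioo 0 b, IsLorentz (g p * Gam b Φ p t) := fun t ht =>
    hg.mul (isLorentz_gam_regularForm hn hs hp hlam hF hr ht)
  have hGA : Tendsto (fun t => g p * Gam b Φ p t) (𝓝[>] 0) (𝓝 (g p * Γ₀)) := hΓ₀.const_mul _
  have hC : EqOn (fun t => pt (C t))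
      (fun t => circleMotion e (q * lam) (g p * Γ₀) (logParam s p t)) (Ioo 0 b) := fun t ht =>
    congrArg (fun B : EndM n => pt ((g p * Γ₀) (B e.o))) (gam_poleForm e hs hp hlam ht)
  have hcal : EqOn (fun t => pt (calapso b c Q lam p t))
      (fun t => circleMotion e (q * lam) (g p * Gam b Φ p t) (logParam s p t)) (Ioo 0 b) :=
    fun t ht => pt_calapso_eq hn hs hp hlam hF hr ht
  exact ⟨fun φ hφ => tendsto_conformalDist_motion hp hlam hA hC hGA hcal hG hφ,
    fun δ hδ => image_motion_eq hs hp hlam hA hC hδ,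
    fun φ hφ => tendsto_speed_motion hs hp hlam hA hC hφ,
    not_exists_tendsto_motion hs hp hlam hA hC hGA hcal,
    setOf_mapClusterPt_motion hs hp hlam hA hC hGA hcal⟩
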